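/- Let $\mathcal G$ be a groupoid; compose its morphisms from left to right and write $\bar g$ for the inverse of $g$ and $1_i$ for the identity of the object $i$. A Hopf $\mathcal G$-algebra in a braided monoidal category (product $\diamond$, unit object $\mathbf 1$, braiding $\gamma$) is a family of objects $H_g$, $g\in\mathcal G$, with morphisms $\Delta_g:H_g\to H_g\diamond H_g$, $\epsilon_g:H_g\to\mathbf 1$, $m_{g,h}:H_g\diamond H_h\to H_{gh}$ (for composable $g,h$), $\eta_i:\mathbf 1\to H_{1_i}$, $S_g,\bar S_g:H_g\to H_{\bar g}$, such that (associativity isomorphisms omitted): $(\Delta_g,\epsilon_g)$ is coassociative and counital; $m$ is associative with two-sided unit $\eta$; $\Delta_{gh}m_{g,h}=(m_{g,h}\diamond m_{g,h})(\mathrm{id}\diamond\gamma_{g,h}\diamond\mathrm{id})(\Delta_g\diamond\Delta_h)$, $\epsilon_{gh}m_{g,h}=\epsilon_g\diamond\epsilon_h$, $\Delta_{1_i}\eta_i=\eta_i\diamond\eta_i$, $\epsilon_{1_i}\eta_i=\mathrm{id}_{\mathbf 1}$; for $g:i\to j$, $m_{\bar g,g}(S_g\diamond\mathrm{id})\Delta_g=\eta_j\epsilon_g$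 and $m_{g,\bar g}(\mathrm{id}\diamond S_g)\Delta_g=\eta_i\epsilon_g$; and $S_{\bar g}\bar S_g=\bar S_{\bar g}S_g=\mathrm{id}$. The universal unimodular Hopf $\mathcal G$-algebra $\mathcal H^u(\mathcal G)$ is the free braided monoidal category with a Hopf $\mathcal G$-algebra $H=\{H_g\}_{g\in\mathcal G}$ and families $l_i:H_{1_i}\to\mathbf 1$ and $L_g:\mathbf 1\to H_g$ such that $(\mathrm{id}\diamond l_i)\Delta_{1_i}=\eta_i l_i$, $\;m_{g,h}(L_g\diamond\mathrm{id}_h)=L_{gh}\epsilon_h$, $\;l_iL_{1_i}=\mathrm{id}_{\mathbf 1}=l_iS_{1_i}L_{1_i}$, $\;S_gL_g=L_{\bar g}$, $\;l_iS_{1_i}=l_i$. For $g:i\to j$ put $\Lambda_g=\Delta_g\circ L_g:\mathbf 1\to H_g\diamond H_g$ and $\lambda_g=l_i\circ m_{g,\bar g}\circ(\mathrm{id}_g\diamond S_g):H_g\diamond H_g\to\mathbf 1$. A braided monoidal category is tortile if every object $A$ is equipped with a dual $A^*$, a coform $\Lambda_A:\mathbf 1\to A^*\diamond A$ and a form $\lambda_A:A\diamond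 A^*\to\mathbf 1$ satisfying the two zigzag identities, and the category is equipped with natural isomorphisms $\theta_A:A\to A$ such that $\theta_{\mathbf 1}=\mathrm{id}$, $\theta_{A\diamond B}=\gamma_{B,A}\circ(\theta_B\diamond\theta_A)\circ\gamma_{A,B}$ and $\theta_{A^*}=(\theta_A)^*$; here, for $F:A\to B$, $F^*=(\mathrm{id}_{A^*}\diamond\lambda_B)(\mathrm{id}_{A^*}\diamond F\diamond\mathrm{id}_{B^*})(\Lambda_A\diamond\mathrm{id}_{B^*}):B^*\to A^*$. **Lemma.** $\mathcal H^u(\mathcal G)$ is tortile, with duals given by $H_g^*=H_g$, $\Lambda_{H_g}=\Lambda_g$, $\lambda_{H_g}=\lambda_g$, by the trivial dual $\mathbf 1^*=\mathbf 1$, and by $(A\diamond B)^*=B^*\diamond A^*$, $\Lambda_{A\diamond B}=(\mathrm{id}_{B^*}\diamond\Lambda_A\diamond\mathrm{id}_B)\circ\Lambda_B$, $\lambda_{A\diamond B}=\lambda_A\circ(\mathrm{id}_A\diamond\lambda_B\diamond\mathrm{id}_{A^*})$, and with a twist such that, for every $g\in\mathcal G$, $$\theta_{H_g}=S_{\bar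 g}\circ S_g .$$ Moreover, for every $g\in\mathcal G$, the following relations hold: $$(\lambda_g\diamond\mathrm{id}_g)\circ(\mathrm{id}_g\diamond\gamma_{g,g})\circ(\Lambda_g\diamond\mathrm{id}_g)=S_{\bar g}\circ S_g=(S_{\bar g}\circ S_g)^*,\tag{f6--6'}$$ $$(\mathrm{id}_{\bar g}\diamond S_{\bar g})\circ\Lambda_{\bar g}=(S_g\diamond\mathrm{id}_g)\circ\Lambda_g,\tag{f7}$$ $$\lambda_g\circ(\mathrm{id}_g\diamond S_{\bar g})=\lambda_{\bar g}\circ(S_g\diamond\mathrm{id}_{\bar g}).\tag{f8}$$ -/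

import Mathlib

open CategoryTheory MonoidalCategory

universe v u

/-- A tortile category: a braided monoidal category in which every object `A` has a chosen dual
`A^*` with coform `1 ⟶ A^* ⊗ A` and form `A ⊗ A^* ⟶ 1` (in Mathlib's terminology this is a
chosen *left* dual, and the dual morphism `F^*` is `leftAdjointMate F`), together with a twist
compatible with the duals. -/
class TortileCategory (C : Type u) [Category.{v} C] [MonoidalCategory.{v} C]
    [BraidedCategory.{v} C] extends LeftRigidCategory C where
  /-- the twist `θ` -/
  twist : ∀ A : C, A ≅ A
  twist_naturality : ∀ {A B : C} (f : A ⟶ B), (twist A).hom ≫ f = f ≫ (twist B).hom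
  twist_unit : (twist (𝟙_ C)).hom = 𝟙 (𝟙_ C)
  twist_tensor : ∀ A B : C, (twist (A ⊗ B)).hom =
    (β_ A B).hom ≫ ((twist B).hom ⊗ₘ (twist A).hom) ≫ (β_ B A).hom
  twist_dual : ∀ A : C, (twist (HasLeftDual.leftDual A)).hom = leftAdjointMate (twist A).hom

/-- The objects of the universal unimodular Hopf `G`-algebra category: formal products of the
generating objects `H_g`, one for each morphism `g` of the groupoid `G`. -/
inductive UniHopf (G : Type u) [Groupoid.{v} G] : Type (max u v)
  /-- the generating object `H_g` -/
  | of {i j : G} (g : i ⟶ j) : UniHopf G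
  | unit : UniHopf G
  | tensor (A B : UniHopf G) : UniHopf G

namespace UniHopf

variable {G : Type u} [Groupoid.{v} G]

/-- Formal morphisms: formal compositions and products of identities, the structure isomorphisms
of a braided monoidal category, and the structure morphisms of a Hopf `G`-algebra with a
cointegral and an integral. Where the label of the target is a product or an inverse in `G`, it is
given together with a proof of the corresponding equation, so that no transport along equalities
of labels is needed. Composition in `G` is written from left to right. -/
inductive Term : UniHopf G → UniHopf G → Type (max u v)
  | id (A : UniHopf G) : Term A A
  | comp {A B C : UniHopf G} (f : Term A B) (g : Term B C) : Term A C
  | tens {A B A' B' : UniHopf G} (f : Term A A') (g : Term B B') :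
      Term (A.tensor B) (A'.tensor B')
  | assoc (A B C : UniHopf G) : Term ((A.tensor B).tensor C) (A.tensor (B.tensor C))
  | assocInv (A B C : UniHopf G) : Term (A.tensor (B.tensor C)) ((A.tensor B).tensor C)
  | lunit (A : UniHopf G) : Term (unit.tensor A) A
  | lunitInv (A : UniHopf G) : Term A (unit.tensor A)
  | runit (A : UniHopf G) : Term (A.tensor unit) A
  | runitInv (A : UniHopf G) : Term A (A.tensor unit)
  | braid (A B : UniHopf G) : Term (A.tensor B) (B.tensor A)
  | braidInv (A B : UniHopf G) : Term (B.tensor A) (A.tensor B)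
  /-- comultiplication `Δ_g : H_g ⟶ H_g ⊗ H_g` -/
  | comul {i j : G} (g : i ⟶ j) : Term (of g) ((of g).tensor (of g))
  /-- counit `ε_g : H_g ⟶ 1` -/
  | counit {i j : G} (g : i ⟶ j) : Term (of g) unit
  /-- multiplication `m_{g,h} : H_g ⊗ H_h ⟶ H_{gh}` -/
  | mul {i j k : G} {g : i ⟶ j} {h : j ⟶ k} {gh : i ⟶ k} (e : g ≫ h = gh) :
      Term ((of g).tensor (of h)) (of gh)
  /-- unit `η_i : 1 ⟶ H_{1_i}` -/
  | one (i : G) : Term unit (of (𝟙 i))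
  /-- antipode `S_g : H_g ⟶ H_{g⁻¹}` -/
  | anti {i j : G} {g : i ⟶ j} {g' : j ⟶ i} (e : Groupoid.inv g = g') : Term (of g) (of g')
  /-- inverse antipode `S̄_g : H_g ⟶ H_{g⁻¹}` -/
  | antiInv {i j : G} {g : i ⟶ j} {g' : j ⟶ i} (e : Groupoid.inv g = g') : Term (of g) (of g')
  /-- cointegral `l_i : H_{1_i} ⟶ 1` -/
  | coint (i : G) : Term (of (𝟙 i)) unit
  /-- integral `L_g : 1 ⟶ H_g` -/
  | integral {i j : G} (g : i ⟶ j) : Term unit (of g)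

open Term

/-- The congruence on formal morphisms generated by the axioms of a braided monoidal category and
those of a unimodular Hopf `G`-algebra with integrals. -/
inductive Rel : ∀ {A B : UniHopf G}, Term A B → Term A B → Prop
  -- equivalence relation, compatible with composition and product
  | refl {A B} (f : Term A B) : Rel f f
  | symm {A B} {f g : Term A B} : Rel f g → Rel g f
  | trans {A B} {f g h : Term A B} : Rel f g → Rel g h → Rel f h
  | comp {A B C} {f f' : Term A B} {g g' : Term B C} :
      Rel f f' → Rel g g' → Rel (f.comp g) (f'.comp g')
  | tens {A B A' B'} {f f' : Term A A'} {g g' : Term B B'} :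
      Rel f f' → Rel g g' → Rel (f.tens g) (f'.tens g')
  -- category
  | id_comp {A B} (f : Term A B) : Rel ((Term.id A).comp f) f
  | comp_id {A B} (f : Term A B) : Rel (f.comp (Term.id B)) f
  | comp_assoc {A B C D} (f : Term A B) (g : Term B C) (h : Term C D) :
      Rel ((f.comp g).comp h) (f.comp (g.comp h))
  -- functoriality of the product
  | id_tens_id (A B : UniHopf G) : Rel ((Term.id A).tens (Term.id B)) (Term.id (A.tensor B))
  | tens_comp_tens {A B C A' B' C'} (f : Term A B) (f' : Term A' B') (g : Term B C)
      (g' : Term B' C') :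
      Rel ((f.tens f').comp (g.tens g')) ((f.comp g).tens (f'.comp g'))
  -- associativity and unit isomorphisms
  | assoc_assocInv (A B C : UniHopf G) : Rel ((assoc A B C).comp (assocInv A B C)) (Term.id _)
  | assocInv_assoc (A B C : UniHopf G) : Rel ((assocInv A B C).comp (assoc A B C)) (Term.id _)
  | assoc_naturality {A B C A' B' C'} (f : Term A A') (g : Term B B') (h : Term C C') :
      Rel (((f.tens g).tens h).comp (assoc A' B' C'))
        ((assoc A B C).comp (f.tens (g.tens h)))
  | lunit_lunitInv (A : UniHopf G) : Rel ((lunit A).comp (lunitInv A)) (Term.id _)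
  | lunitInv_lunit (A : UniHopf G) : Rel ((lunitInv A).comp (lunit A)) (Term.id _)
  | lunit_naturality {A B} (f : Term A B) :
      Rel (((Term.id unit).tens f).comp (lunit B)) ((lunit A).comp f)
  | runit_runitInv (A : UniHopf G) : Rel ((runit A).comp (runitInv A)) (Term.id _)
  | runitInv_runit (A : UniHopf G) : Rel ((runitInv A).comp (runit A)) (Term.id _)
  | runit_naturality {A B} (f : Term A B) :
      Rel ((f.tens (Term.id unit)).comp (runit B)) ((runit A).comp f)
  | pentagon (A B C D : UniHopf G) :
      Rel (((assoc A B C).tens (Term.id D)).comp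
          ((assoc A (B.tensor C) D).comp ((Term.id A).tens (assoc B C D))))
        ((assoc (A.tensor B) C D).comp (assoc A B (C.tensor D)))
  | triangle (A B : UniHopf G) :
      Rel ((assoc A unit B).comp ((Term.id A).tens (lunit B))) ((runit A).tens (Term.id B))
  -- braiding
  | braid_braidInv (A B : UniHopf G) : Rel ((braid A B).comp (braidInv A B)) (Term.id _)
  | braidInv_braid (A B : UniHopf G) : Rel ((braidInv A B).comp (braid A B)) (Term.id _)
  | braid_naturality {A B A' B'} (f : Term A A') (g : Term B B') :
      Rel ((f.tens g).comp (braid A' B')) ((braid A B).comp (g.tens f))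
  | hexagon_forward (A B C : UniHopf G) :
      Rel ((assoc A B C).comp ((braid A (B.tensor C)).comp (assoc B C A)))
        (((braid A B).tens (Term.id C)).comp
          ((assoc B A C).comp ((Term.id B).tens (braid A C))))
  | hexagon_reverse (A B C : UniHopf G) :
      Rel ((assocInv A B C).comp ((braid (A.tensor B) C).comp (assocInv C A B)))
        (((Term.id A).tens (braid B C)).comp
          ((assocInv A C B).comp ((braid A C).tens (Term.id B))))
  -- coalgebra axioms
  | comul_coassoc {i j : G} (g : i ⟶ j) :
      Rel ((comul g).comp (((comul g).tens (Term.id _)).comp (assoc _ _ _)))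
        ((comul g).comp ((Term.id _).tens (comul g)))
  | counit_comul {i j : G} (g : i ⟶ j) :
      Rel ((comul g).comp (((counit g).tens (Term.id _)).comp (lunit _))) (Term.id _)
  | comul_counit {i j : G} (g : i ⟶ j) :
      Rel ((comul g).comp (((Term.id _).tens (counit g)).comp (runit _))) (Term.id _)
  -- algebra axioms
  | mul_assoc {i j k m : G} {f : i ⟶ j} {g : j ⟶ k} {h : k ⟶ m} {fg : i ⟶ k} {gh : j ⟶ m}
      {fgh : i ⟶ m} (e₁ : f ≫ g = fg) (e₂ : fg ≫ h = fgh) (e₃ : g ≫ h = gh)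
      (e₄ : f ≫ gh = fgh) :
      Rel (((mul e₁).tens (Term.id (of h))).comp (mul e₂))
        ((assoc _ _ _).comp (((Term.id (of f)).tens (mul e₃)).comp (mul e₄)))
  | mul_one {i j : G} (g : i ⟶ j) :
      Rel ((runitInv (of g)).comp (((Term.id _).tens (one j)).comp (mul (Category.comp_id g))))
        (Term.id _)
  | one_mul {i j : G} (g : i ⟶ j) :
      Rel ((lunitInv (of g)).comp (((one i).tens (Term.id _)).comp (mul (Category.id_comp g))))
        (Term.id _)
  -- compatibility of the algebra and coalgebra structures
  | mul_comul {i j k : G} {g : i ⟶ j} {h : j ⟶ k} {gh : i ⟶ k} (e : g ≫ h = gh) :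
      Rel (((comul g).tens (comul h)).comp
          ((assoc _ _ _).comp
            (((Term.id (of g)).tens
              ((assocInv _ _ _).comp
                (((braid (of g) (of h)).tens (Term.id (of h))).comp (assoc _ _ _)))).comp
              ((assocInv _ _ _).comp ((mul e).tens (mul e))))))
        ((mul e).comp (comul gh))
  | mul_counit {i j k : G} {g : i ⟶ j} {h : j ⟶ k} {gh : i ⟶ k} (e : g ≫ h = gh) :
      Rel ((mul e).comp (counit gh)) (((counit g).tens (counit h)).comp (lunit unit))
  | one_comul (i : G) :
      Rel ((one i).comp (comul (𝟙 i))) ((lunitInv unit).comp ((one i).tens (one i)))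
  | one_counit (i : G) : Rel ((one i).comp (counit (𝟙 i))) (Term.id unit)
  -- antipode axioms
  | anti_left {i j : G} {g : i ⟶ j} {g' : j ⟶ i} (e : Groupoid.inv g = g')
      (e' : g' ≫ g = 𝟙 j) :
      Rel ((comul g).comp (((anti e).tens (Term.id (of g))).comp (mul e')))
        ((counit g).comp (one j))
  | anti_right {i j : G} {g : i ⟶ j} {g' : j ⟶ i} (e : Groupoid.inv g = g')
      (e' : g ≫ g' = 𝟙 i) :
      Rel ((comul g).comp (((Term.id (of g)).tens (anti e)).comp (mul e')))
        ((counit g).comp (one i))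
  | antiInv_anti {i j : G} {g : i ⟶ j} {g' : j ⟶ i} (e : Groupoid.inv g = g')
      (e' : Groupoid.inv g' = g) : Rel ((antiInv e).comp (anti e')) (Term.id _)
  | anti_antiInv {i j : G} {g : i ⟶ j} {g' : j ⟶ i} (e : Groupoid.inv g = g')
      (e' : Groupoid.inv g' = g) : Rel ((anti e).comp (antiInv e')) (Term.id _)
  -- `l` is a left cointegral, `L` is a right integral, and they are normalized
  | coint_left (i : G) :
      Rel ((comul (𝟙 i)).comp (((Term.id _).tens (coint i)).comp (runit _)))
        ((coint i).comp (one i))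
  | integral_right {i j k : G} {g : i ⟶ j} {h : j ⟶ k} {gh : i ⟶ k} (e : g ≫ h = gh) :
      Rel ((lunitInv (of h)).comp (((integral g).tens (Term.id (of h))).comp (mul e)))
        ((counit h).comp (integral gh))
  | integral_coint (i : G) : Rel ((integral (𝟙 i)).comp (coint i)) (Term.id unit)
  | integral_anti_coint (i : G) (e : Groupoid.inv (𝟙 i) = 𝟙 i) :
      Rel ((integral (𝟙 i)).comp ((anti e).comp (coint i))) (Term.id unit)
  -- unimodularity
  | integral_anti {i j : G} {g : i ⟶ j} {g' : j ⟶ i} (e : Groupoid.inv g = g') :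
      Rel ((integral g).comp (anti e)) (integral g')
  | anti_coint (i : G) (e : Groupoid.inv (𝟙 i) = 𝟙 i) :
      Rel ((anti e).comp (coint i)) (coint i)

instance termSetoid (A B : UniHopf G) : Setoid (Term A B) where
  r := Rel
  iseqv := ⟨Rel.refl, Rel.symm, Rel.trans⟩

instance : Category.{max u v} (UniHopf G) where
  Hom A B := _root_.Quotient (termSetoid A B)
  id A := ⟦Term.id A⟧
  comp := Quotient.map₂ Term.comp (fun _ _ hf _ _ hg => Rel.comp hf hg)
  id_comp := by
    rintro A B ⟨f⟩
    exact Quotient.sound (Rel.id_comp f)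
  comp_id := by
    rintro A B ⟨f⟩
    exact Quotient.sound (Rel.comp_id f)
  assoc := by
    rintro A B C D ⟨f⟩ ⟨g⟩ ⟨h⟩
    exact Quotient.sound (Rel.comp_assoc f g h)

/-- The morphism of the category represented by a formal morphism. -/
def mk {A B : UniHopf G} (f : Term A B) : A ⟶ B := Quotient.mk (termSetoid A B) f

instance : MonoidalCategory (UniHopf G) where
  tensorObj := tensor
  tensorUnit := unit
  tensorHom := Quotient.map₂ Term.tens (fun _ _ hf _ _ hg => Rel.tens hf hg)
  whiskerLeft A _ _ := Quotient.map (Term.tens (Term.id A))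
    (fun _ _ h => Rel.tens (Rel.refl _) h)
  whiskerRight f B := Quotient.map (fun f => Term.tens f (Term.id B))
    (fun _ _ h => Rel.tens h (Rel.refl _)) f
  associator A B C := ⟨mk (assoc A B C), mk (assocInv A B C),
    Quotient.sound (Rel.assoc_assocInv A B C), Quotient.sound (Rel.assocInv_assoc A B C)⟩
  leftUnitor A := ⟨mk (lunit A), mk (lunitInv A),
    Quotient.sound (Rel.lunit_lunitInv A), Quotient.sound (Rel.lunitInv_lunit A)⟩
  rightUnitor A := ⟨mk (runit A), mk (runitInv A),
    Quotient.sound (Rel.runit_runitInv A), Quotient.sound (Rel.runitInv_runit A)⟩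
  tensorHom_def := by
    rintro A B C D ⟨f⟩ ⟨g⟩
    exact Quotient.sound (((Rel.tens_comp_tens _ _ _ _).trans
      (Rel.tens (Rel.comp_id _) (Rel.id_comp _))).symm)
  id_tensorHom_id A B := Quotient.sound (Rel.id_tens_id A B)
  tensorHom_comp_tensorHom := by
    rintro _ _ _ _ _ _ ⟨f⟩ ⟨f'⟩ ⟨g⟩ ⟨g'⟩
    exact Quotient.sound (Rel.tens_comp_tens f f' g g')
  whiskerLeft_id A B := Quotient.sound (Rel.id_tens_id A B)
  id_whiskerRight A B := Quotient.sound (Rel.id_tens_id A B)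
  associator_naturality := by
    rintro _ _ _ _ _ _ ⟨f⟩ ⟨g⟩ ⟨h⟩
    exact Quotient.sound (Rel.assoc_naturality f g h)
  leftUnitor_naturality := by
    rintro _ _ ⟨f⟩
    exact Quotient.sound (Rel.lunit_naturality f)
  rightUnitor_naturality := by
    rintro _ _ ⟨f⟩
    exact Quotient.sound (Rel.runit_naturality f)
  pentagon A B C D := Quotient.sound (Rel.pentagon A B C D)
  triangle A B := Quotient.sound (Rel.triangle A B)

instance : BraidedCategory (UniHopf G) where
  braiding A B := ⟨mk (braid A B), mk (braidInv A B),
    Quotient.sound (Rel.braid_braidInv A B), Quotient.sound (Rel.braidInv_braid A B)⟩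
  braiding_naturality_right := by
    rintro A _ _ ⟨f⟩
    exact Quotient.sound (Rel.braid_naturality (Term.id A) f)
  braiding_naturality_left := by
    rintro _ _ ⟨f⟩ B
    exact Quotient.sound (Rel.braid_naturality f (Term.id B))
  hexagon_forward A B C := Quotient.sound (Rel.hexagon_forward A B C)
  hexagon_reverse A B C := Quotient.sound (Rel.hexagon_reverse A B C)

/-- The antipode `S_g : H_g ⟶ H_{g⁻¹}`. -/
def S {i j : G} (g : i ⟶ j) : of g ⟶ of (Groupoid.inv g) := mk (anti rfl)

/-- The antipode `S_{g⁻¹} : H_{g⁻¹} ⟶ H_g`, where `(g⁻¹)⁻¹` is identified with `g`. -/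
def SOfInv {i j : G} (g : i ⟶ j) : of (Groupoid.inv g) ⟶ of g := mk (anti (by simp))

/-- The coform `Λ_g = Δ_g ∘ L_g : 1 ⟶ H_g ⊗ H_g`. -/
def coform {i j : G} (g : i ⟶ j) : 𝟙_ (UniHopf G) ⟶ of g ⊗ of g :=
  mk (integral g) ≫ mk (comul g)

/-- The form `λ_g = l_i ∘ m_{g,g⁻¹} ∘ (id ⊗ S_g) : H_g ⊗ H_g ⟶ 1`, for `g : i ⟶ j`. -/
def form {i j : G} (g : i ⟶ j) : of g ⊗ of g ⟶ 𝟙_ (UniHopf G) :=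
  of g ◁ S g ≫ mk (mul (Groupoid.comp_inv g)) ≫ mk (coint i)

end UniHopf

-- Everything is the Sweedler calculus of Hopf algebras with integrals, made braided and labelled;
-- in the comments below Δx is written x₁ ⊗ x₂ and crossings are suppressed.
--
-- Convolution inverses are unique even when products are only partially defined. Both S(xy) and
-- S(y)S(x) invert the multiplication, and both Δ(Sx) and S(x₂) ⊗ S(x₁) invert Δ, so S reverses
-- products and coproducts up to a braiding (`mul_anti`, `anti_comul`). Since S is invertible and
-- preserves L, the right integral is also a left one (`mul_integral`). The zigzags then read L₁
-- l(L₂ S(x)) = x (`coform_form`) and l(x S(L₁)) L₂ = x (`form_coform`).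
--
-- Invariance of l under S says that undoing a crossing in front of the form inserts S² on its first
-- leg (`braiding_inv_form`), so the curl straightens to S². Transporting this to the coform and
-- using SL = L gives the compatibility of S with the coform. This means that S_g is the dual of
-- S_{g⁻¹}; the relation for the form and the self-duality of S² follow.
--
-- The twist is S² on generators and is extended to products by the required formula. By freeness,
-- naturality has to be checked only on generating morphisms: for m and Δ the two reversals by S
-- produce exactly the double braiding, and for the associator both sides are the full twist of
-- three strands. Compatibility with duals is an induction on objects, since dualizing reverses
-- products and sends braidings to braidings.

universe v₁ u₁

/-! ### Strand calculus: morphisms acting on the leading factors of a right nested product. -/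

namespace Strand

variable {C : Type u₁} [Category.{v₁} C] [MonoidalCategory C]
  {A A' B B' D E R R' R'' : C}

/-- A morphism `A ⊗ B ⟶ D` acting on the first two factors of a right nested product. -/
def act21 (f : A ⊗ B ⟶ D) {R : C} : A ⊗ B ⊗ R ⟶ D ⊗ R := (α_ A B R).inv ≫ f ▷ R

/-- A morphism `A ⟶ B ⊗ D` acting on the first factor of a right nested product. -/
def act12 (f : A ⟶ B ⊗ D) {R : C} : A ⊗ R ⟶ B ⊗ D ⊗ R := f ▷ R ≫ (α_ B D R).hom

/-- A morphism `A ⟶ 𝟙` acting on the first factor of a right nested product. -/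
def act10 (f : A ⟶ 𝟙_ C) {R : C} : A ⊗ R ⟶ R := f ▷ R ≫ (λ_ R).hom

/-- A morphism `𝟙 ⟶ A` creating the first factor of a right nested product. -/
def act01 (f : 𝟙_ C ⟶ A) {R : C} : R ⟶ A ⊗ R := (λ_ R).inv ≫ f ▷ R

/-- A morphism `A ⊗ B ⟶ D ⊗ E` acting on the first two factors of a right nested product. -/
def act22 (f : A ⊗ B ⟶ D ⊗ E) {R : C} : A ⊗ B ⊗ R ⟶ D ⊗ E ⊗ R :=
  (α_ A B R).inv ≫ f ▷ R ≫ (α_ D E R).hom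

/-- A morphism `A ⊗ B ⟶ 𝟙` acting on the first two factors of a right nested product. -/
def act20 (f : A ⊗ B ⟶ 𝟙_ C) {R : C} : A ⊗ B ⊗ R ⟶ R := (α_ A B R).inv ≫ f ▷ R ≫ (λ_ R).hom

/-- A morphism `𝟙 ⟶ A ⊗ B` creating the first two factors of a right nested product. -/
def act02 (f : 𝟙_ C ⟶ A ⊗ B) {R : C} : R ⟶ A ⊗ B ⊗ R := (λ_ R).inv ≫ f ▷ R ≫ (α_ A B R).hom

/-- Whiskering with the unit object is faithful, so an equation may be proved with an arbitrary
remainder `R` and then specialized. This is how the strand computations return to plain morphisms.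
-/
theorem ext11 {f g : A ⟶ B} (h : f ▷ 𝟙_ C = g ▷ 𝟙_ C) : f = g := (whiskerRight_iff f g).1 h

theorem ext21 {f g : A ⊗ B ⟶ D} (h : act21 f (R := 𝟙_ C) = act21 g) : f = g :=
  ext11 (by simpa [act21, -whiskerRight_id] using h)

theorem ext12 {f g : A ⟶ B ⊗ D} (h : act12 f (R := 𝟙_ C) = act12 g) : f = g :=
  ext11 (by simpa [act12, -whiskerRight_id] using h)

theorem ext10 {f g : A ⟶ 𝟙_ C} (h : act10 f (R := 𝟙_ C) = act10 g) : f = g :=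
  ext11 (by simpa [act10, -whiskerRight_id] using h)

theorem ext01 {f g : 𝟙_ C ⟶ A} (h : act01 f (R := 𝟙_ C) = act01 g) : f = g :=
  ext11 (by simpa [act01, -whiskerRight_id] using h)

theorem ext02 {f g : 𝟙_ C ⟶ A ⊗ B} (h : act02 f (R := 𝟙_ C) = act02 g) : f = g :=
  ext11 (by simpa [act02, -whiskerRight_id] using h)

/-! ### Naturality in the remaining factors -/

theorem nat11 (f : A ⟶ B) (r : R ⟶ R') : f ▷ R ≫ B ◁ r = A ◁ r ≫ f ▷ R' :=
  (whisker_exchange f r).symm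

theorem nat21 (f : A ⊗ B ⟶ D) (r : R ⟶ R') : act21 f ≫ D ◁ r = A ◁ B ◁ r ≫ act21 f := by
  simp [act21, ← whisker_exchange]

theorem nat12 (f : A ⟶ B ⊗ D) (r : R ⟶ R') : act12 f ≫ B ◁ D ◁ r = A ◁ r ≫ act12 f := by
  simp only [act12, whisker_exchange_assoc]
  monoidal

/-- The primed variants apply when the morphism to be slid shares a whiskering with what follows it.
-/
theorem nat12' (f : A ⟶ B ⊗ D) (r : R ⟶ R') (s : D ⊗ R' ⟶ R'') :
    act12 f ≫ B ◁ (D ◁ r ≫ s) = A ◁ r ≫ act12 f ≫ B ◁ s := by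
  rw [whiskerLeft_comp, reassoc_of% nat12]

theorem nat10 (f : A ⟶ 𝟙_ C) (r : R ⟶ R') : act10 f ≫ r = A ◁ r ≫ act10 f := by
  simp [act10, whisker_exchange_assoc]

theorem nat01 (f : 𝟙_ C ⟶ A) (r : R ⟶ R') : act01 f ≫ A ◁ r = r ≫ act01 f := by
  simp [act01, ← whisker_exchange]

theorem nat22 (f : A ⊗ B ⟶ D ⊗ E) (r : R ⟶ R') :
    act22 f ≫ D ◁ E ◁ r = A ◁ B ◁ r ≫ act22 f := by
  dsimp only [act22]
  calc
    _ = 𝟙 _ ⊗≫ (f ▷ R ≫ (D ⊗ E) ◁ r) ⊗≫ 𝟙 _ := by monoidal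
    _ = _ := by rw [← whisker_exchange]; monoidal

theorem nat22' (f : A ⊗ B ⟶ D ⊗ E) (r : R ⟶ R') (s : E ⊗ R' ⟶ R'') :
    act22 f ≫ D ◁ (E ◁ r ≫ s) = A ◁ B ◁ r ≫ act22 f ≫ D ◁ s := by
  rw [whiskerLeft_comp, reassoc_of% nat22]

theorem nat20 (f : A ⊗ B ⟶ 𝟙_ C) (r : R ⟶ R') : act20 f ≫ r = A ◁ B ◁ r ≫ act20 f := by
  dsimp only [act20]
  calc
    _ = 𝟙 _ ⊗≫ (f ▷ R ≫ 𝟙_ C ◁ r) ⊗≫ 𝟙 _ := by monoidal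
    _ = _ := by rw [← whisker_exchange]; monoidal

theorem nat02 (f : 𝟙_ C ⟶ A ⊗ B) (r : R ⟶ R') : act02 f ≫ A ◁ B ◁ r = r ≫ act02 f := by
  dsimp only [act02]
  calc
    _ = 𝟙 _ ⊗≫ (f ▷ R ≫ (A ⊗ B) ◁ r) ⊗≫ 𝟙 _ := by monoidal
    _ = _ := by rw [← whisker_exchange]; monoidal

theorem nat02' (f : 𝟙_ C ⟶ A ⊗ B) (r : R ⟶ R') (s : B ⊗ R' ⟶ R'') :
    act02 f ≫ A ◁ (B ◁ r ≫ s) = r ≫ act02 f ≫ A ◁ s := by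
  rw [whiskerLeft_comp, reassoc_of% nat02]

/-! ### Naturality of the braiding -/

variable [BraidedCategory C] {F : C}

theorem braid_inv (A B : C) :
    act22 (β_ A B).hom (R := R) ≫ act22 (β_ A B).inv = 𝟙 _ := by
  simp [act22]

theorem braid_left11 (f : A ⟶ B) :
    f ▷ (F ⊗ R) ≫ act22 (β_ B F).hom = act22 (β_ A F).hom ≫ F ◁ f ▷ R := by
  dsimp only [act22]
  calc
    _ = 𝟙 _ ⊗≫ (f ▷ F ≫ (β_ B F).hom) ▷ R ⊗≫ 𝟙 _ := by monoidal
    _ = _ := by rw [BraidedCategory.braiding_naturality_left]; monoidal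

theorem braid_right11 (f : A ⟶ B) :
    F ◁ f ▷ R ≫ act22 (β_ F B).hom = act22 (β_ F A).hom ≫ f ▷ (F ⊗ R) := by
  dsimp only [act22]
  calc
    _ = 𝟙 _ ⊗≫ (F ◁ f ≫ (β_ F B).hom) ▷ R ⊗≫ 𝟙 _ := by monoidal
    _ = _ := by rw [BraidedCategory.braiding_naturality_right]; monoidal

/-- By the hexagon, crossing `F` with both outputs in turn is crossing it with `B ⊗ D`, so
naturality moves `f` through. -/
theorem braid_left12 (f : A ⟶ B ⊗ D) :
    act12 f (R := F ⊗ R) ≫ B ◁ act22 (β_ D F).hom (R := R) ≫ act22 (β_ B F).hom (R := D ⊗ R) =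
      act22 (β_ A F).hom (R := R) ≫ F ◁ act12 f (R := R) := by
  dsimp only [act22, act12]
  calc
    _ = 𝟙 _ ⊗≫ (f ▷ F ≫ (β_ (B ⊗ D) F).hom) ▷ R ⊗≫ 𝟙 _ := by
      rw [BraidedCategory.braiding_tensor_left_hom]
      monoidal
    _ = _ := by
      rw [BraidedCategory.braiding_naturality_left]
      monoidal

theorem braid_right12 (f : A ⟶ B ⊗ D) :
    F ◁ act12 f (R := R) ≫ act22 (β_ F B).hom (R := D ⊗ R) ≫ B ◁ act22 (β_ F D).hom (R := R) =
      act22 (β_ F A).hom (R := R) ≫ act12 f (R := F ⊗ R) := by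
  dsimp only [act22, act12]
  calc
    _ = 𝟙 _ ⊗≫ (F ◁ f ≫ (β_ F (B ⊗ D)).hom) ▷ R ⊗≫ 𝟙 _ := by
      rw [BraidedCategory.braiding_tensor_right_hom]
      monoidal
    _ = _ := by
      rw [BraidedCategory.braiding_naturality_right]
      monoidal

/-- A crossing with the unit object is trivial, so a strand that ends or begins absorbs its
crossings; the same holds below for caps and cups. -/
theorem braid_left10 (f : A ⟶ 𝟙_ C) :
    act10 f (R := F ⊗ R) =
      act22 (β_ A F).hom (R := R) ≫ F ◁ act10 f (R := R) := by
  dsimp only [act22, act10]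
  calc
    _ = 𝟙 _ ⊗≫ (f ▷ F ≫ (β_ (𝟙_ C) F).hom) ▷ R ⊗≫ 𝟙 _ := by
      rw [braiding_tensorUnit_left]
      monoidal
    _ = _ := by
      rw [BraidedCategory.braiding_naturality_left]
      monoidal

theorem braid_right10 (f : A ⟶ 𝟙_ C) :
    F ◁ act10 f (R := R) =
      act22 (β_ F A).hom (R := R) ≫ act10 f (R := F ⊗ R) := by
  dsimp only [act22, act10]
  calc
    _ = 𝟙 _ ⊗≫ (F ◁ f ≫ (β_ F (𝟙_ C)).hom) ▷ R ⊗≫ 𝟙 _ := by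
      rw [braiding_tensorUnit_right]
      monoidal
    _ = _ := by
      rw [BraidedCategory.braiding_naturality_right]
      monoidal

theorem braid_right01 (f : 𝟙_ C ⟶ A) :
    F ◁ act01 f (R := R) ≫ act22 (β_ F A).hom (R := R) =
      act01 f (R := F ⊗ R) := by
  dsimp only [act22, act01]
  calc
    _ = 𝟙 _ ⊗≫ (F ◁ f ≫ (β_ F A).hom) ▷ R ⊗≫ 𝟙 _ := by monoidal
    _ = _ := by
      rw [BraidedCategory.braiding_naturality_right, braiding_tensorUnit_right]
      monoidal

theorem braid_left20 (f : A ⊗ B ⟶ 𝟙_ C) :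
    act20 f (R := F ⊗ R) =
      A ◁ act22 (β_ B F).hom (R := R) ≫ act22 (β_ A F).hom (R := B ⊗ R) ≫ F ◁ act20 f (R := R) := by
  dsimp only [act22, act20]
  calc
    _ = 𝟙 _ ⊗≫ (f ▷ F ≫ (β_ (𝟙_ C) F).hom) ▷ R ⊗≫ 𝟙 _ := by
      rw [braiding_tensorUnit_left]
      monoidal
    _ = _ := by
      rw [BraidedCategory.braiding_naturality_left, BraidedCategory.braiding_tensor_left_hom]
      monoidal

theorem braid_left02 (f : 𝟙_ C ⟶ A ⊗ B) :
    act02 f (R := F ⊗ R) ≫ A ◁ act22 (β_ B F).hom (R := R) ≫ act22 (β_ A F).hom (R := B ⊗ R) =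
      F ◁ act02 f (R := R) := by
  dsimp only [act22, act02]
  calc
    _ = 𝟙 _ ⊗≫ (f ▷ F ≫ (β_ (A ⊗ B) F).hom) ▷ R ⊗≫ 𝟙 _ := by
      rw [BraidedCategory.braiding_tensor_left_hom]
      monoidal
    _ = _ := by
      rw [BraidedCategory.braiding_naturality_left, braiding_tensorUnit_left]
      monoidal

theorem braid_right02 (f : 𝟙_ C ⟶ A ⊗ B) :
    F ◁ act02 f (R := R) ≫ act22 (β_ F A).hom (R := B ⊗ R) ≫ A ◁ act22 (β_ F B).hom (R := R) =
      act02 f (R := F ⊗ R) := by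
  dsimp only [act22, act02]
  calc
    _ = 𝟙 _ ⊗≫ (F ◁ f ≫ (β_ F (A ⊗ B)).hom) ▷ R ⊗≫ 𝟙 _ := by
      rw [BraidedCategory.braiding_tensor_right_hom]
      monoidal
    _ = _ := by
      rw [BraidedCategory.braiding_naturality_right, braiding_tensorUnit_right]
      monoidal

end Strand

/-! ### Convolution inverses, and the Hopf axioms acting on strands. -/

open Strand

/-- In a partially defined convolution algebra, a left inverse equals a right inverse. -/
theorem convolution_left_inv_eq_right_inv {C : Type u₁} [Category.{v₁} C] [MonoidalCategory C]
    {D U F I J : C} {δ : D ⟶ D ⊗ D} {e : D ⟶ 𝟙_ C}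
    (coassoc : δ ≫ δ ▷ D ≫ (α_ D D D).hom = δ ≫ D ◁ δ)
    (counit_left : δ ≫ e ▷ D ≫ (λ_ D).hom = 𝟙 D) (counit_right : δ ≫ D ◁ e ≫ (ρ_ D).hom = 𝟙 D)
    {mUF : U ⊗ F ⟶ I} {mFU : F ⊗ U ⟶ J} {mIU : I ⊗ U ⟶ U} {mUJ : U ⊗ J ⟶ U}
    {oneI : 𝟙_ C ⟶ I} {oneJ : 𝟙_ C ⟶ J}
    (assoc : mUF ▷ U ≫ mIU = (α_ U F U).hom ≫ U ◁ mFU ≫ mUJ)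
    (one_mul : (λ_ U).inv ≫ oneI ▷ U ≫ mIU = 𝟙 U) (mul_one : (ρ_ U).inv ≫ U ◁ oneJ ≫ mUJ = 𝟙 U)
    {a b : D ⟶ U} {f : D ⟶ F} (left : δ ≫ (a ⊗ₘ f) ≫ mUF = e ≫ oneI)
    (right : δ ≫ (f ⊗ₘ b) ≫ mFU = e ≫ oneJ) : a = b := by
  have coassoc' {R : C} : act12 δ (R := R) ≫ act12 δ = act12 δ ≫ D ◁ act12 δ := by
    calc
      _ = 𝟙 _ ⊗≫ (δ ≫ δ ▷ D ≫ (α_ D D D).hom) ▷ R ⊗≫ 𝟙 _ := by dsimp only [act12]; monoidal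
      _ = _ := by rw [coassoc]; dsimp only [act12]; monoidal
  have counit_left' {R : C} : act12 δ (R := R) ≫ act10 e = 𝟙 _ := by
    calc
      _ = 𝟙 _ ⊗≫ (δ ≫ e ▷ D ≫ (λ_ D).hom) ▷ R ⊗≫ 𝟙 _ := by dsimp only [act12, act10]; monoidal
      _ = _ := by rw [counit_left]; monoidal
  have counit_right' {R : C} : act12 δ (R := R) ≫ D ◁ act10 e = 𝟙 _ := by
    calc
      _ = 𝟙 _ ⊗≫ (δ ≫ D ◁ e ≫ (ρ_ D).hom) ▷ R ⊗≫ 𝟙 _ := by dsimp only [act12, act10]; monoidal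
      _ = _ := by rw [counit_right]; monoidal
  have assoc' {R : C} : act21 mUF ≫ act21 mIU = U ◁ act21 mFU ≫ act21 mUJ (R := R) := by
    calc
      _ = 𝟙 _ ⊗≫ (mUF ▷ U ≫ mIU) ▷ R ⊗≫ 𝟙 _ := by dsimp only [act21]; monoidal
      _ = _ := by rw [assoc]; dsimp only [act21]; monoidal
  have one_mul' {R : C} : act01 oneI ≫ act21 mIU = 𝟙 (U ⊗ R) := by
    calc
      _ = 𝟙 _ ⊗≫ ((λ_ U).inv ≫ oneI ▷ U ≫ mIU) ▷ R ⊗≫ 𝟙 _ := by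
        dsimp only [act21, act01]; monoidal
      _ = _ := by rw [one_mul]; monoidal
  have mul_one' {R : C} : U ◁ act01 oneJ ≫ act21 mUJ = 𝟙 (U ⊗ R) := by
    calc
      _ = 𝟙 _ ⊗≫ ((ρ_ U).inv ≫ U ◁ oneJ ≫ mUJ) ▷ R ⊗≫ 𝟙 _ := by
        dsimp only [act21, act01]; monoidal
      _ = _ := by rw [mul_one]; monoidal
  have left' {R : C} : act12 δ (R := R) ≫ a ▷ _ ≫ U ◁ f ▷ R ≫ act21 mUF =
      act10 e ≫ act01 oneI := by
    calc
      _ = 𝟙 _ ⊗≫ (δ ≫ (a ⊗ₘ f) ≫ mUF) ▷ R ⊗≫ 𝟙 _ := by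
        rw [MonoidalCategory.tensorHom_def]; dsimp only [act12, act21]; monoidal
      _ = _ := by rw [left]; dsimp only [act10, act01]; monoidal
  have right' {R : C} : act12 δ (R := R) ≫ f ▷ _ ≫ F ◁ b ▷ R ≫ act21 mFU =
      act10 e ≫ act01 oneJ := by
    calc
      _ = 𝟙 _ ⊗≫ (δ ≫ (f ⊗ₘ b) ≫ mFU) ▷ R ⊗≫ 𝟙 _ := by
        rw [MonoidalCategory.tensorHom_def]; dsimp only [act12, act21]; monoidal
      _ = _ := by rw [right]; dsimp only [act10, act01]; monoidal
  -- The computation a = a * (f * b) = (a * f) * b = b, with `mUF`, `mFU`, `mIU`, `mUJ` in place of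
  -- a single product.
  apply ext11
  calc
    _ = act12 δ ≫ D ◁ act10 e ≫ a ▷ _ ≫ U ◁ act01 oneJ ≫ act21 mUJ := by
      rw [mul_one', Category.comp_id, reassoc_of% counit_right']
    _ = act12 δ ≫ a ▷ _ ≫ U ◁ (act12 δ ≫ f ▷ _ ≫ F ◁ b ▷ _ ≫ act21 mFU) ≫ act21 mUJ := by
      rw [right']; simp only [reassoc_of% nat11, whiskerLeft_comp, Category.assoc]
    _ = (act12 δ ≫ D ◁ act12 δ) ≫ a ▷ _ ≫ U ◁ f ▷ _ ≫ act21 mUF ≫ I ◁ b ▷ _ ≫ act21 mIU := by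
      rw [reassoc_of% nat21, assoc']
      simp only [reassoc_of% nat11, ← whiskerLeft_comp_assoc, Category.assoc]
    _ = act12 δ ≫ (act12 δ ≫ a ▷ _ ≫ U ◁ f ▷ _ ≫ act21 mUF) ≫ I ◁ b ▷ _ ≫ act21 mIU := by
      rw [← coassoc']; simp only [Category.assoc]
    _ = _ := by
      rw [left', Category.assoc, reassoc_of% counit_left', reassoc_of% nat01, one_mul', Category.comp_id]

/-- A family of objects of a braided monoidal category with the structure of a Hopf `G`-algebra
with invertible antipode, and with integrals and cointegrals which are normalized and invariant
under the antipode. Labels of products and inverses are given by equations. -/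
structure UnimodularHopf (G : Type u) [Groupoid.{v} G] (C : Type u₁) [Category.{v₁} C]
    [MonoidalCategory C] [BraidedCategory C] where
  obj {i j : G} (g : i ⟶ j) : C
  comul {i j : G} (g : i ⟶ j) : obj g ⟶ obj g ⊗ obj g
  counit {i j : G} (g : i ⟶ j) : obj g ⟶ 𝟙_ C
  mul {i j k : G} {g : i ⟶ j} {h : j ⟶ k} {gh : i ⟶ k} (e : g ≫ h = gh) : obj g ⊗ obj h ⟶ obj gh
  one (i : G) : 𝟙_ C ⟶ obj (𝟙 i)
  anti {i j : G} {g : i ⟶ j} {g' : j ⟶ i} (e : Groupoid.inv g = g') : obj g ⟶ obj g'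
  antiInv {i j : G} {g : i ⟶ j} {g' : j ⟶ i} (e : Groupoid.inv g = g') : obj g ⟶ obj g'
  coint (i : G) : obj (𝟙 i) ⟶ 𝟙_ C
  integral {i j : G} (g : i ⟶ j) : 𝟙_ C ⟶ obj g
  comul_coassoc {i j : G} (g : i ⟶ j) :
    comul g ≫ comul g ▷ obj g ≫ (α_ _ _ _).hom = comul g ≫ obj g ◁ comul g
  counit_comul {i j : G} (g : i ⟶ j) : comul g ≫ counit g ▷ obj g ≫ (λ_ _).hom = 𝟙 _
  comul_counit {i j : G} (g : i ⟶ j) : comul g ≫ obj g ◁ counit g ≫ (ρ_ _).hom = 𝟙 _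
  mul_assoc {i j k m : G} {f : i ⟶ j} {g : j ⟶ k} {h : k ⟶ m} {fg : i ⟶ k} {gh : j ⟶ m}
    {fgh : i ⟶ m} (e₁ : f ≫ g = fg) (e₂ : fg ≫ h = fgh) (e₃ : g ≫ h = gh) (e₄ : f ≫ gh = fgh) :
    mul e₁ ▷ obj h ≫ mul e₂ = (α_ _ _ _).hom ≫ obj f ◁ mul e₃ ≫ mul e₄
  mul_one {i j : G} (g : i ⟶ j) :
    (ρ_ _).inv ≫ obj g ◁ one j ≫ mul (Category.comp_id g) = 𝟙 _
  one_mul {i j : G} (g : i ⟶ j) :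
    (λ_ _).inv ≫ one i ▷ obj g ≫ mul (Category.id_comp g) = 𝟙 _
  mul_comul {i j k : G} {g : i ⟶ j} {h : j ⟶ k} {gh : i ⟶ k} (e : g ≫ h = gh) :
    (comul g ⊗ₘ comul h) ≫ tensorμ _ _ _ _ ≫ (mul e ⊗ₘ mul e) = mul e ≫ comul gh
  mul_counit {i j k : G} {g : i ⟶ j} {h : j ⟶ k} {gh : i ⟶ k} (e : g ≫ h = gh) :
    mul e ≫ counit gh = (counit g ⊗ₘ counit h) ≫ (λ_ _).hom
  one_comul (i : G) : one i ≫ comul (𝟙 i) = (λ_ _).inv ≫ (one i ⊗ₘ one i)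
  one_counit (i : G) : one i ≫ counit (𝟙 i) = 𝟙 _
  anti_left {i j : G} {g : i ⟶ j} {g' : j ⟶ i} (e : Groupoid.inv g = g') (e' : g' ≫ g = 𝟙 j) :
    comul g ≫ anti e ▷ obj g ≫ mul e' = counit g ≫ one j
  anti_right {i j : G} {g : i ⟶ j} {g' : j ⟶ i} (e : Groupoid.inv g = g') (e' : g ≫ g' = 𝟙 i) :
    comul g ≫ obj g ◁ anti e ≫ mul e' = counit g ≫ one i
  antiInv_anti {i j : G} {g : i ⟶ j} {g' : j ⟶ i} (e : Groupoid.inv g = g')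
    (e' : Groupoid.inv g' = g) : antiInv e ≫ anti e' = 𝟙 _
  anti_antiInv {i j : G} {g : i ⟶ j} {g' : j ⟶ i} (e : Groupoid.inv g = g')
    (e' : Groupoid.inv g' = g) : anti e ≫ antiInv e' = 𝟙 _
  coint_left (i : G) : comul (𝟙 i) ≫ obj (𝟙 i) ◁ coint i ≫ (ρ_ _).hom = coint i ≫ one i
  integral_right {i j k : G} {g : i ⟶ j} {h : j ⟶ k} {gh : i ⟶ k} (e : g ≫ h = gh) :
    (λ_ _).inv ≫ integral g ▷ obj h ≫ mul e = counit h ≫ integral gh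
  integral_coint (i : G) : integral (𝟙 i) ≫ coint i = 𝟙 _
  integral_anti {i j : G} {g : i ⟶ j} {g' : j ⟶ i} (e : Groupoid.inv g = g') :
    integral g ≫ anti e = integral g'
  anti_coint (i : G) (e : Groupoid.inv (𝟙 i) = 𝟙 i) : anti e ≫ coint i = coint i

namespace UnimodularHopf

variable {G : Type u} [Groupoid.{v} G] {C : Type u₁} [Category.{v₁} C]
    [MonoidalCategory C] [BraidedCategory C] (H : UnimodularHopf G C)
  {i j k m : G} {R : C}

/-! ### The axioms in terms of strands -/

theorem coassoc (g : i ⟶ j) :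
    act12 (H.comul g) (R := R) ≫ act12 (H.comul g) =
      act12 (H.comul g) ≫ H.obj g ◁ act12 (H.comul g) := by
  calc
    _ = 𝟙 _ ⊗≫ (H.comul g ≫ H.comul g ▷ H.obj g ≫ (α_ _ _ _).hom) ▷ R ⊗≫ 𝟙 _ := by
      dsimp only [act12]; monoidal
    _ = _ := by rw [comul_coassoc]; dsimp only [act12]; monoidal

theorem counit_left (g : i ⟶ j) :
    act12 (H.comul g) (R := R) ≫ act10 (H.counit g) = 𝟙 _ := by
  calc
    _ = 𝟙 _ ⊗≫ (H.comul g ≫ H.counit g ▷ H.obj g ≫ (λ_ _).hom) ▷ R ⊗≫ 𝟙 _ := by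
      dsimp only [act12, act10]; monoidal
    _ = _ := by rw [counit_comul]; monoidal

theorem counit_right (g : i ⟶ j) :
    act12 (H.comul g) (R := R) ≫ H.obj g ◁ act10 (H.counit g) = 𝟙 _ := by
  calc
    _ = 𝟙 _ ⊗≫ (H.comul g ≫ H.obj g ◁ H.counit g ≫ (ρ_ _).hom) ▷ R ⊗≫ 𝟙 _ := by
      dsimp only [act12, act10]; monoidal
    _ = _ := by rw [comul_counit]; monoidal

theorem assoc {f : i ⟶ j} {g : j ⟶ k} {h : k ⟶ m} {fg : i ⟶ k} {gh : j ⟶ m}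
    {fgh : i ⟶ m} (e₁ : f ≫ g = fg) (e₂ : fg ≫ h = fgh) (e₃ : g ≫ h = gh) (e₄ : f ≫ gh = fgh) :
    act21 (H.mul e₁) ≫ act21 (H.mul e₂) (R := R) =
      H.obj f ◁ act21 (H.mul e₃) ≫ act21 (H.mul e₄) := by
  calc
    _ = 𝟙 _ ⊗≫ (H.mul e₁ ▷ H.obj h ≫ H.mul e₂) ▷ R ⊗≫ 𝟙 _ := by dsimp only [act21]; monoidal
    _ = _ := by rw [H.mul_assoc e₁ e₂ e₃ e₄]; dsimp only [act21]; monoidal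

theorem one_left {g : i ⟶ j} (e : 𝟙 i ≫ g = g) :
    act01 (H.one i) ≫ act21 (H.mul e) (R := R) = 𝟙 _ := by
  calc
    _ = 𝟙 _ ⊗≫ ((λ_ _).inv ≫ H.one i ▷ H.obj g ≫ H.mul e) ▷ R ⊗≫ 𝟙 _ := by
      dsimp only [act21, act01]; monoidal
    _ = _ := by rw [one_mul]; monoidal

theorem one_right {g : i ⟶ j} (e : g ≫ 𝟙 j = g) :
    H.obj g ◁ act01 (H.one j) ≫ act21 (H.mul e) (R := R) = 𝟙 _ := by
  calc
    _ = 𝟙 _ ⊗≫ ((ρ_ _).inv ≫ H.obj g ◁ H.one j ≫ H.mul e) ▷ R ⊗≫ 𝟙 _ := by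
      dsimp only [act21, act01]; monoidal
    _ = _ := by rw [mul_one]; monoidal

theorem bialgebra {g : i ⟶ j} {h : j ⟶ k} {gh : i ⟶ k} (e : g ≫ h = gh) :
    act21 (H.mul e) ≫ act12 (H.comul gh) (R := R) =
      act12 (H.comul g) ≫ H.obj g ◁ H.obj g ◁ act12 (H.comul h) ≫
        H.obj g ◁ act22 (β_ (H.obj g) (H.obj h)).hom ≫ act21 (H.mul e) ≫
          H.obj gh ◁ act21 (H.mul e) := by
  calc
    _ = 𝟙 _ ⊗≫ (H.mul e ≫ H.comul gh) ▷ R ⊗≫ 𝟙 _ := by dsimp only [act21, act12]; monoidal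
    _ = _ := by
      rw [← mul_comul, MonoidalCategory.tensorHom_def, MonoidalCategory.tensorHom_def]; dsimp only [act21, act12, act22, tensorμ]; monoidal

theorem mul_act10_counit {g : i ⟶ j} {h : j ⟶ k} {gh : i ⟶ k} (e : g ≫ h = gh) :
    act21 (H.mul e) ≫ act10 (H.counit gh) (R := R) =
      act10 (H.counit g) ≫ act10 (H.counit h) := by
  calc
    _ = 𝟙 _ ⊗≫ (H.mul e ≫ H.counit gh) ▷ R ⊗≫ 𝟙 _ := by dsimp only [act21, act10]; monoidal
    _ = _ := by rw [mul_counit, MonoidalCategory.tensorHom_def]; dsimp only [act10]; monoidal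

theorem one_act12_comul (i : G) :
    act01 (H.one i) ≫ act12 (H.comul (𝟙 i)) (R := R) = act01 (H.one i) ≫ act01 (H.one i) := by
  calc
    _ = 𝟙 _ ⊗≫ (H.one i ≫ H.comul (𝟙 i)) ▷ R ⊗≫ 𝟙 _ := by dsimp only [act01, act12]; monoidal
    _ = _ := by rw [one_comul, MonoidalCategory.tensorHom_def']; dsimp only [act01]; monoidal

theorem antipode_left {g : i ⟶ j} {g' : j ⟶ i} (e : Groupoid.inv g = g') (e' : g' ≫ g = 𝟙 j) :
    act12 (H.comul g) (R := R) ≫ H.anti e ▷ _ ≫ act21 (H.mul e') =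
      act10 (H.counit g) ≫ act01 (H.one j) := by
  calc
    _ = 𝟙 _ ⊗≫ (H.comul g ≫ H.anti e ▷ H.obj g ≫ H.mul e') ▷ R ⊗≫ 𝟙 _ := by
      dsimp only [act12, act21]; monoidal
    _ = _ := by rw [anti_left]; dsimp only [act10, act01]; monoidal

theorem antipode_right {g : i ⟶ j} {g' : j ⟶ i} (e : Groupoid.inv g = g') (e' : g ≫ g' = 𝟙 i) :
    act12 (H.comul g) (R := R) ≫ H.obj g ◁ H.anti e ▷ _ ≫ act21 (H.mul e') =
      act10 (H.counit g) ≫ act01 (H.one i) := by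
  calc
    _ = 𝟙 _ ⊗≫ (H.comul g ≫ H.obj g ◁ H.anti e ≫ H.mul e') ▷ R ⊗≫ 𝟙 _ := by
      dsimp only [act12, act21]; monoidal
    _ = _ := by rw [anti_right]; dsimp only [act10, act01]; monoidal

theorem coint_comul (i : G) :
    act12 (H.comul (𝟙 i)) (R := R) ≫ H.obj (𝟙 i) ◁ act10 (H.coint i) =
      act10 (H.coint i) ≫ act01 (H.one i) := by
  calc
    _ = 𝟙 _ ⊗≫ (H.comul (𝟙 i) ≫ H.obj (𝟙 i) ◁ H.coint i ≫ (ρ_ _).hom) ▷ R ⊗≫ 𝟙 _ := by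
      dsimp only [act12, act10]; monoidal
    _ = _ := by rw [coint_left]; dsimp only [act10, act01]; monoidal

theorem integral_mul {g : i ⟶ j} {h : j ⟶ k} {gh : i ⟶ k} (e : g ≫ h = gh) :
    act01 (H.integral g) ≫ act21 (H.mul e) (R := R) =
      act10 (H.counit h) ≫ act01 (H.integral gh) := by
  calc
    _ = 𝟙 _ ⊗≫ ((λ_ _).inv ≫ H.integral g ▷ H.obj h ≫ H.mul e) ▷ R ⊗≫ 𝟙 _ := by
      dsimp only [act21, act01]; monoidal
    _ = _ := by rw [integral_right]; dsimp only [act10, act01]; monoidal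

theorem integral_act10_coint (i : G) :
    act01 (H.integral (𝟙 i)) ≫ act10 (H.coint i) (R := R) = 𝟙 _ := by
  calc
    _ = 𝟙 _ ⊗≫ (H.integral (𝟙 i) ≫ H.coint i) ▷ R ⊗≫ 𝟙 _ := by
      dsimp only [act10, act01]; monoidal
    _ = _ := by rw [integral_coint]; monoidal

end UnimodularHopf

/-! ### The antipode reverses products and coproducts. -/

theorem tensorμ_tensorHom_assoc {C : Type u₁} [Category.{v₁} C] [MonoidalCategory C]
    [BraidedCategory C] {A A' B B' D D' E E' F F' K K' : C}
    {m₁ : A ⊗ B ⟶ E} {m₂ : E ⊗ D ⟶ K} {m₃ : B ⊗ D ⟶ F} {m₄ : A ⊗ F ⟶ K}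
    {n₁ : A' ⊗ B' ⟶ E'} {n₂ : E' ⊗ D' ⟶ K'} {n₃ : B' ⊗ D' ⟶ F'} {n₄ : A' ⊗ F' ⟶ K'}
    (hm : m₁ ▷ D ≫ m₂ = (α_ A B D).hom ≫ A ◁ m₃ ≫ m₄)
    (hn : n₁ ▷ D' ≫ n₂ = (α_ A' B' D').hom ≫ A' ◁ n₃ ≫ n₄) :
    (tensorμ A A' B B' ≫ (m₁ ⊗ₘ n₁)) ▷ (D ⊗ D') ≫ tensorμ E E' D D' ≫ (m₂ ⊗ₘ n₂) =
      (α_ _ _ _).hom ≫ (A ⊗ A') ◁ (tensorμ B B' D D' ≫ (m₃ ⊗ₘ n₃)) ≫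
        tensorμ A A' F F' ≫ (m₄ ⊗ₘ n₄) := by
  rw [comp_whiskerRight, Category.assoc, tensorμ_natural_left_assoc, tensorHom_comp_tensorHom,
    hm, hn, ← tensorHom_comp_tensorHom, tensor_associativity_assoc, whiskerLeft_comp,
    Category.assoc, tensorμ_natural_right_assoc, tensorHom_comp_tensorHom]

namespace UnimodularHopf

variable {G : Type u} [Groupoid.{v} G] {C : Type u₁} [Category.{v₁} C]
    [MonoidalCategory C] [BraidedCategory C] (H : UnimodularHopf G C)
  {i j k m : G} {R : C}

theorem one_act10_counit (i : G) :
    act01 (H.one i) ≫ act10 (H.counit (𝟙 i)) (R := R) = 𝟙 _ := by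
  calc
    _ = 𝟙 _ ⊗≫ (H.one i ≫ H.counit (𝟙 i)) ▷ R ⊗≫ 𝟙 _ := by dsimp only [act10, act01]; monoidal
    _ = _ := by rw [one_counit]; monoidal

/-- Apply ε to S(x₁)x₂ = ε(x)1: the result is ε(Sx₁)ε(x₂) = ε(x), and counitality removes the second
factor. -/
theorem antipode_act10_counit {g : i ⟶ j} {g' : j ⟶ i} (e : Groupoid.inv g = g') :
    H.anti e ▷ R ≫ act10 (H.counit g') = act10 (H.counit g) := by
  have e' : g' ≫ g = 𝟙 j := by simp [← e]
  have h := H.antipode_left e e' (R := R) =≫ act10 (H.counit (𝟙 j))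
  simp only [Category.assoc, one_act10_counit, Category.comp_id, mul_act10_counit] at h
  rwa [nat10, reassoc_of% nat11, reassoc_of% counit_right] at h

theorem one_antipode (e : Groupoid.inv (𝟙 i) = 𝟙 i) :
    act01 (H.one i) ≫ H.anti e ▷ R = act01 (H.one i) := by
  have h := act01 (H.one i) ≫= H.antipode_left e (Category.comp_id _) (R := R)
  rwa [reassoc_of% one_act10_counit, reassoc_of% one_act12_comul, ← reassoc_of% nat01, ← reassoc_of% nat11, one_right,
    Category.comp_id] at h

/-- Makes the coalgebra structure on H_g ⊗ H_h available, with its coassociativity and counit laws;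
`mul_anti` convolves over it. -/
instance comonObj (g : i ⟶ j) : ComonObj (H.obj g) where
  counit := H.counit g
  comul := H.comul g
  counit_comul := by rw [← cancel_mono (λ_ _).hom]; simpa using H.counit_comul g
  comul_counit := by rw [← cancel_mono (ρ_ _).hom]; simpa using H.comul_counit g
  comul_assoc := (H.comul_coassoc g).symm

/-- In the convolution of maps out of H_g ⊗ H_h, the left side is a left inverse of the
multiplication and the right side is a right inverse. -/
theorem mul_anti {g : i ⟶ j} {h : j ⟶ k} {gh : i ⟶ k} {g' : j ⟶ i} {h' : k ⟶ j} {gh' : k ⟶ i}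
    (e : g ≫ h = gh) (eg : Groupoid.inv g = g') (eh : Groupoid.inv h = h')
    (egh : Groupoid.inv gh = gh') (e' : h' ≫ g' = gh') :
    H.mul e ≫ H.anti egh =
      (β_ (H.obj g) (H.obj h)).hom ≫ (H.anti eh ⊗ₘ H.anti eg) ≫ H.mul e' := by
  have e₁ : gh' ≫ gh = 𝟙 k := by simp [← egh]
  have e₂ : gh ≫ gh' = 𝟙 i := by simp [← egh]
  have e₃ : h ≫ gh' = g' := by simp [← egh, ← e, ← eg]
  have e₄ : g ≫ g' = 𝟙 i := by simp [← eg]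
  have e₅ : h ≫ h' = 𝟙 j := by simp [← eh]
  refine convolution_left_inv_eq_right_inv (D := H.obj g ⊗ H.obj h)
    (δ := (H.comul g ⊗ₘ H.comul h) ≫ tensorμ _ _ _ _)
    (e := (H.counit g ⊗ₘ H.counit h) ≫ (λ_ _).hom) ?_ ?_ ?_
    (H.mul_assoc e₁ (Category.id_comp _) e₂ (Category.comp_id _)) (H.one_mul gh') (H.mul_one gh')
    (f := H.mul e) ?_ ?_
  · have := (ComonObj.comul_assoc (H.obj g ⊗ H.obj h)).symm
    rwa [Comon.tensorObj_comul] at this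
  · have := ComonObj.counit_comul (H.obj g ⊗ H.obj h) =≫ (λ_ _).hom
    rwa [Comon.tensorObj_comul, Comon.tensorObj_counit, Iso.inv_hom_id, Category.assoc] at this
  · have := ComonObj.comul_counit (H.obj g ⊗ H.obj h) =≫ (ρ_ _).hom
    rwa [Comon.tensorObj_comul, Comon.tensorObj_counit, Iso.inv_hom_id, Category.assoc] at this
  · have h₁ : (H.mul e ≫ H.anti egh) ⊗ₘ H.mul e =
        (H.mul e ⊗ₘ H.mul e) ≫ H.anti egh ▷ H.obj gh := by simp [tensorHom_comp_whiskerRight]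
    have h₂ := H.mul_comul e =≫ (H.anti egh ▷ H.obj gh ≫ H.mul e₁)
    simp only [Category.assoc] at h₂
    rw [h₁, Category.assoc, Category.assoc, h₂, H.anti_left, reassoc_of% H.mul_counit e,
      Category.assoc]
  -- Right inverse: in x₁y₁S(y₂)S(x₂) the inner pair y₁S(y₂) collapses first, then x₁S(x₂).
  · apply ext21
    calc
      _ = act12 (H.comul g) ≫ H.obj g ◁ H.obj g ◁ act12 (H.comul h) ≫
          H.obj g ◁ act22 (β_ (H.obj g) (H.obj h)).hom ≫ act21 (H.mul e) ≫
          H.obj gh ◁ (act22 (β_ (H.obj g) (H.obj h)).hom ≫ H.anti eh ▷ _ ≫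
            H.obj h' ◁ H.anti eg ▷ _ ≫ act21 (H.mul e')) ≫ act21 (H.mul e₂) := by
        simp only [MonoidalCategory.tensorHom_def]; dsimp only [act12, act21, act22, tensorμ]
        monoidal
      _ = act12 (H.comul g) ≫ H.obj g ◁ (H.obj g ◁ act12 (H.comul h) ≫
          act22 (β_ (H.obj g) (H.obj h)).hom ≫ H.obj h ◁ act22 (β_ (H.obj g) (H.obj h)).hom ≫
          H.obj h ◁ H.anti eh ▷ _ ≫ H.obj h ◁ H.obj h' ◁ H.anti eg ▷ _ ≫
          H.obj h ◁ act21 (H.mul e') ≫ act21 (H.mul e₃)) ≫ act21 (H.mul e₄) := by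
        rw [reassoc_of% nat21, H.assoc e e₂ e₃ e₄]
        simp only [whiskerLeft_comp, Category.assoc]
      _ = act12 (H.comul g) ≫ H.obj g ◁ (H.anti eg ▷ _ ≫ H.obj g' ◁ act10 (H.counit h)) ≫
          act21 (H.mul e₄) := by
        congr 3
        rw [reassoc_of% braid_right12, ← H.assoc e₅ (Category.id_comp _) e' e₃, ← whiskerLeft_comp_assoc,
          nat11, whiskerLeft_comp_assoc, reassoc_of% nat12, reassoc_of% H.antipode_right eh e₅, one_left,
          Category.comp_id, ← reassoc_of% braid_left11, ← braid_right10]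
      _ = act10 (H.counit g) ≫ act10 (H.counit h) ≫ act01 (H.one i) := by
        rw [whiskerLeft_comp, Category.assoc, ← nat21, reassoc_of% H.antipode_right eg e₄, nat01]
      _ = _ := by
        simp only [MonoidalCategory.tensorHom_def]; dsimp only [act10, act01, act21]
        monoidal

/-- Dual to `mul_anti`: both sides invert Δ_g in the convolution of maps from H_g to products H ⊗ H,
whose multiplication is the braided one and is associative by `tensorμ_tensorHom_assoc`. -/
theorem anti_comul {g : i ⟶ j} {g' : j ⟶ i} (e : Groupoid.inv g = g') :
    H.anti e ≫ H.comul g' =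
      H.comul g ≫ (β_ (H.obj g) (H.obj g)).hom ≫ (H.anti e ⊗ₘ H.anti e) := by
  have e₁ : g' ≫ g = 𝟙 j := by simp [← e]
  have e₂ : g ≫ g' = 𝟙 i := by simp [← e]
  refine convolution_left_inv_eq_right_inv (H.comul_coassoc g) (H.counit_comul g)
    (H.comul_counit g)
    (tensorμ_tensorHom_assoc (H.mul_assoc e₁ (Category.id_comp _) e₂ (Category.comp_id _))
      (H.mul_assoc e₁ (Category.id_comp _) e₂ (Category.comp_id _)))
    (oneI := (λ_ _).inv ≫ (H.one j ⊗ₘ H.one j)) (oneJ := (λ_ _).inv ≫ (H.one i ⊗ₘ H.one i))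
    ?_ ?_ (f := H.comul g) ?_ ?_
  · have h : H.one j ▷ H.obj g' ≫ H.mul (Category.id_comp g') = (λ_ _).hom := by
      rw [← Iso.inv_comp_eq_id, H.one_mul]
    rw [comp_whiskerRight_assoc, tensorμ_natural_left_assoc, tensorHom_comp_tensorHom, h,
      ← tensor_left_unitality, Iso.inv_hom_id]
  · have h : H.obj g' ◁ H.one i ≫ H.mul (Category.comp_id g') = (ρ_ _).hom := by
      rw [← Iso.inv_comp_eq_id, H.mul_one]
    rw [whiskerLeft_comp_assoc, tensorμ_natural_right_assoc, tensorHom_comp_tensorHom, h,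
      ← tensor_right_unitality, Iso.inv_hom_id]
  · have h₁ : (H.anti e ≫ H.comul g') ⊗ₘ H.comul g =
        H.anti e ▷ H.obj g ≫ (H.comul g' ⊗ₘ H.comul g) :=
      (whiskerRight_comp_tensorHom _ _ _).symm
    rw [h₁, Category.assoc, H.mul_comul, reassoc_of% H.anti_left e e₁, H.one_comul]
  · apply ext12
    calc
      _ = act12 (H.comul g) ≫ act12 (H.comul g) ≫ H.obj g ◁ H.obj g ◁ (act12 (H.comul g) ≫
          act22 (β_ (H.obj g) (H.obj g)).hom ≫ H.anti e ▷ _ ≫ H.obj g' ◁ H.anti e ▷ _) ≫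
          H.obj g ◁ act22 (β_ (H.obj g) (H.obj g')).hom ≫
          act21 (H.mul e₂) ≫ H.obj (𝟙 i) ◁ act21 (H.mul e₂) := by
        simp only [MonoidalCategory.tensorHom_def]; dsimp only [act12, act21, act22, tensorμ]
        monoidal
      _ = act12 (H.comul g) ≫ H.obj g ◁ (H.obj g ◁ act01 (H.one i) ≫ H.anti e ▷ _) ≫
          act21 (H.mul e₂) := by
        -- In S(p₃) ⊗ p₁S(p₂) the second factor collapses, leaving S(p) ⊗ 1; the outer pair x₁S(x₂)
        -- is then treated in the same way.
        have key : act12 (H.comul g) ≫ H.obj g ◁ (act12 (H.comul g) ≫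
            act22 (β_ (H.obj g) (H.obj g)).hom ≫ H.anti e ▷ _ ≫ H.obj g' ◁ H.anti e ▷ 𝟙_ C) ≫
            act22 (β_ (H.obj g) (H.obj g')).hom ≫ H.obj g' ◁ act21 (H.mul e₂) =
            H.obj g ◁ act01 (H.one i) ≫ H.anti e ▷ _ := by
          rw [nat11]
          simp only [whiskerLeft_comp, Category.assoc]
          rw [reassoc_of% braid_right11, ← reassoc_of% nat22, nat11, ← reassoc_of% H.coassoc, reassoc_of% braid_left12]
          rw [← whiskerLeft_comp_assoc, ← whiskerLeft_comp_assoc, Category.assoc,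
            H.antipode_right e e₂, whiskerLeft_comp_assoc, ← reassoc_of% braid_left10, reassoc_of% counit_left]
        rw [← key, nat21, reassoc_of% H.coassoc]
        simp only [whiskerLeft_comp, Category.assoc]
      _ = act10 (H.counit g) ≫ act01 (H.one i) ≫ act01 (H.one i) := by
        rw [whiskerLeft_comp, Category.assoc, reassoc_of% nat12, H.antipode_right e e₂, ← reassoc_of% nat10]
      _ = _ := by
        rw [MonoidalCategory.tensorHom_def']; dsimp only [act10, act01, act12]
        monoidal

end UnimodularHopf

/-! ### Integrals, cointegrals and the zigzag identities. -/

namespace UnimodularHopf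

variable {G : Type u} [Groupoid.{v} G] {C : Type u₁} [Category.{v₁} C]
    [MonoidalCategory C] [BraidedCategory C] (H : UnimodularHopf G C)
  {i j k m : G} {R : C}

theorem mul_antipode {g : i ⟶ j} {h : j ⟶ k} {gh : i ⟶ k} {g' : j ⟶ i} {h' : k ⟶ j}
    {gh' : k ⟶ i} (e : g ≫ h = gh) (eg : Groupoid.inv g = g') (eh : Groupoid.inv h = h')
    (egh : Groupoid.inv gh = gh') (e' : h' ≫ g' = gh') :
    act21 (H.mul e) ≫ H.anti egh ▷ R =
      act22 (β_ (H.obj g) (H.obj h)).hom ≫ H.anti eh ▷ _ ≫ H.obj h' ◁ H.anti eg ▷ R ≫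
        act21 (H.mul e') := by
  calc
    _ = 𝟙 _ ⊗≫ (H.mul e ≫ H.anti egh) ▷ R ⊗≫ 𝟙 _ := by dsimp only [act21]; monoidal
    _ = _ := by
      rw [H.mul_anti e eg eh egh e', MonoidalCategory.tensorHom_def]; dsimp only [act21, act22]
      monoidal

theorem antipode_comul {g : i ⟶ j} {g' : j ⟶ i} (e : Groupoid.inv g = g') :
    H.anti e ▷ R ≫ act12 (H.comul g') =
      act12 (H.comul g) ≫ act22 (β_ (H.obj g) (H.obj g)).hom ≫ H.anti e ▷ _ ≫
        H.obj g' ◁ H.anti e ▷ R := by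
  calc
    _ = 𝟙 _ ⊗≫ (H.anti e ≫ H.comul g') ▷ R ⊗≫ 𝟙 _ := by dsimp only [act12]; monoidal
    _ = _ := by
      rw [H.anti_comul e, MonoidalCategory.tensorHom_def]; dsimp only [act12, act22]; monoidal

theorem integral_antipode {g : i ⟶ j} {g' : j ⟶ i} (e : Groupoid.inv g = g') :
    act01 (H.integral g) ≫ H.anti e ▷ R = act01 (H.integral g') := by
  rw [act01, Category.assoc, ← comp_whiskerRight, integral_anti, act01]

instance {g : i ⟶ j} {g' : j ⟶ i} (e : Groupoid.inv g = g') : IsIso (H.anti e) :=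
  ⟨H.antiInv (g := g') (by simp [← e]), H.anti_antiInv _ _, H.antiInv_anti _ _⟩

/-- S is invertible, reverses products, and preserves integrals and counits, so applying it turns
the right integral property into the left one. -/
theorem mul_integral {g : i ⟶ j} {h : j ⟶ k} {gh : i ⟶ k} (e : g ≫ h = gh) :
    H.obj g ◁ act01 (H.integral h) ≫ act21 (H.mul e) (R := R) =
      act10 (H.counit g) ≫ act01 (H.integral gh) := by
  have e' : Groupoid.inv h ≫ Groupoid.inv g = Groupoid.inv gh := by simp [← e]
  rw [← cancel_mono (H.anti (rfl : Groupoid.inv gh = _) ▷ R), Category.assoc, Category.assoc,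
    H.mul_antipode e rfl rfl rfl e', reassoc_of% braid_right01, reassoc_of% integral_antipode,
    reassoc_of% nat01, integral_mul, reassoc_of% antipode_act10_counit, integral_antipode]

theorem comul_comul_antipode_right {g : i ⟶ j} {g' : j ⟶ i} (e : Groupoid.inv g = g')
    (e' : g ≫ g' = 𝟙 i) :
    act12 (H.comul g) ≫ act12 (H.comul g) ≫ H.obj g ◁ H.obj g ◁ H.anti e ▷ R ≫
      H.obj g ◁ act21 (H.mul e') = H.obj g ◁ act01 (H.one i) := by
  rw [reassoc_of% H.coassoc, ← whiskerLeft_comp, ← whiskerLeft_comp, H.antipode_right e e',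
    whiskerLeft_comp, reassoc_of% H.counit_right]

theorem comul_comul_antipode_left {g : i ⟶ j} {g' : j ⟶ i} (e : Groupoid.inv g = g')
    (e' : g' ≫ g = 𝟙 j) :
    act12 (H.comul g) ≫ H.obj g ◁ (act12 (H.comul g) ≫ H.anti e ▷ _ ≫ act21 (H.mul e')) =
      H.obj g ◁ act01 (H.one j) (R := R) := by
  rw [H.antipode_left e e', whiskerLeft_comp, reassoc_of% H.counit_right]

/-- Translating a coform by right multiplication on its first factor. -/
theorem coform_mul {g : i ⟶ j} {g' : j ⟶ i} (e : Groupoid.inv g = g') (e' : g ≫ g' = 𝟙 i) :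
    act01 (H.integral g) ≫ act12 (H.comul g) ≫ H.obj g ◁ H.obj g ◁ H.anti e ▷ R ≫
        H.obj g ◁ act21 (H.mul e') =
      act01 (H.integral (𝟙 i)) ≫ act12 (H.comul (𝟙 i)) ≫
        H.obj (𝟙 i) ◁ act22 (β_ (H.obj (𝟙 i)) (H.obj g)).hom ≫
          act21 (H.mul (Category.id_comp g)) := by
  -- The identity is L₁ ⊗ L₂S(x) = L₁x ⊗ L₂, with L = L_g on the left and L_{1_i} on the right.
  -- Write x as ε(x₁)x₂ and replace ε(x₁)L_g by L_{1_i}x₁; then Δ(Lx₁) is multiplicative and the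
  -- surplus x₂S(x₃) cancels.
  calc
    _ = act12 (H.comul g) ≫ (act10 (H.counit g) ≫ act01 (H.integral g)) ≫ act12 (H.comul g) ≫
        H.obj g ◁ H.obj g ◁ H.anti e ▷ R ≫ H.obj g ◁ act21 (H.mul e') := by
      rw [Category.assoc, reassoc_of% counit_left]
    _ = act01 (H.integral (𝟙 i)) ≫ act12 (H.comul (𝟙 i)) ≫
        H.obj (𝟙 i) ◁ H.obj (𝟙 i) ◁ (act12 (H.comul g) ≫ act12 (H.comul g) ≫
          H.obj g ◁ H.obj g ◁ H.anti e ▷ R ≫ H.obj g ◁ act21 (H.mul e')) ≫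
        H.obj (𝟙 i) ◁ act22 (β_ (H.obj (𝟙 i)) (H.obj g)).hom ≫
          act21 (H.mul (Category.id_comp g)) ≫
            H.obj g ◁ act21 (H.mul (Category.id_comp (𝟙 i))) := by
      rw [← H.integral_mul (Category.id_comp g), Category.assoc, reassoc_of% H.bialgebra]
      simp only [nat12', reassoc_of% nat12', reassoc_of% nat01, reassoc_of% nat21, nat21, nat22',
        ← whiskerLeft_comp_assoc, ← whiskerLeft_comp, Category.assoc,
        H.assoc (Category.id_comp g) e' e' (Category.id_comp (𝟙 i))]
    _ = _ := by
      rw [H.comul_comul_antipode_right e e', ← whiskerLeft_comp_assoc, ← nat22,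
        whiskerLeft_comp_assoc, ← reassoc_of% nat21, ← whiskerLeft_comp, one_right, whiskerLeft_id,
        Category.comp_id]

/-- Applying l after `coform_mul` gives L₁ l(L₂ S(x)) = L₁ l(L₂) x = l(L) x = x, by the cointegral
property and the normalization. -/
theorem coform_form {g : i ⟶ j} {g' : j ⟶ i} (e : Groupoid.inv g = g') (e' : g ≫ g' = 𝟙 i) :
    act01 (H.integral g) ≫ act12 (H.comul g) ≫ H.obj g ◁ H.obj g ◁ H.anti e ▷ R ≫
        H.obj g ◁ act21 (H.mul e') ≫ H.obj g ◁ act10 (H.coint i) = 𝟙 _ := by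
  rw [reassoc_of% H.coform_mul e e', nat21, ← whiskerLeft_comp_assoc, ← braid_left10,
    reassoc_of% H.coint_comul, one_left, Category.comp_id, integral_act10_coint]

/-- The cointegral identity l(z)1 = z₁ l(z₂) at z = xS(y). As S reverses Δ, this becomes l(xS(y))1 =
x₁S(y₂) l(x₂S(y₁)). -/
theorem mul_antipode_coint_comul {g : i ⟶ j} {g' : j ⟶ i} (e : Groupoid.inv g = g')
    (e' : g ≫ g' = 𝟙 i) :
    H.obj g ◁ H.anti e ▷ R ≫ act21 (H.mul e') ≫ act10 (H.coint i) ≫ act01 (H.one i) =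
      act12 (H.comul g) ≫ H.obj g ◁ (H.obj g ◁ act12 (H.comul g) ≫
        act20 (H.obj g ◁ H.anti e ≫ H.mul e' ≫ H.coint i) ≫ H.anti e ▷ R) ≫
          act21 (H.mul e') := by
  have h {R : C} : act20 (H.obj g ◁ H.anti e ≫ H.mul e' ≫ H.coint i) (R := R) =
      H.obj g ◁ H.anti e ▷ R ≫ act21 (H.mul e') ≫ act10 (H.coint i) := by
    dsimp only [act20, act21, act10]; monoidal
  rw [braid_left20, h, ← H.coint_comul, reassoc_of% H.bialgebra]
  calc
    _ = act12 (H.comul g) ≫ H.obj g ◁ H.obj g ◁ (H.anti e ▷ R ≫ act12 (H.comul g')) ≫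
        H.obj g ◁ act22 (β_ (H.obj g) (H.obj g')).hom ≫ act21 (H.mul e') ≫
        H.obj (𝟙 i) ◁ (act21 (H.mul e') ≫ act10 (H.coint i)) := by
      simp only [reassoc_of% nat12, whiskerLeft_comp, Category.assoc]
    _ = act12 (H.comul g) ≫ H.obj g ◁ (H.obj g ◁ (act12 (H.comul g) ≫
        act22 (β_ (H.obj g) (H.obj g)).hom ≫ H.anti e ▷ _ ≫ H.obj g' ◁ H.anti e ▷ R) ≫
        act22 (β_ (H.obj g) (H.obj g')).hom ≫ H.obj g' ◁ (act21 (H.mul e') ≫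
          act10 (H.coint i))) ≫ act21 (H.mul e') := by
      rw [H.antipode_comul e, nat21]
      simp only [whiskerLeft_comp, Category.assoc]
    _ = _ := by
      congr 3
      rw [nat11]
      simp only [whiskerLeft_comp, Category.assoc]
      rw [reassoc_of% braid_right11, ← reassoc_of% nat22, reassoc_of% nat11, nat11]

/-- One of the zigzag identities. -/
theorem form_coform {g : i ⟶ j} {g' : j ⟶ i} (e : Groupoid.inv g = g') (e' : g ≫ g' = 𝟙 i) :
    H.obj g ◁ act01 (H.integral g) ≫ H.obj g ◁ act12 (H.comul g) ≫ H.obj g ◁ H.anti e ▷ _ ≫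
        act21 (H.mul e') ≫ act10 (H.coint i) = 𝟙 (H.obj g ⊗ R) := by
  have e'' : g' ≫ g = 𝟙 j := by simp [← e]
  -- Insert a unit and expand l(xS(L₁))1 by the previous lemma. Then l(xS(L₁))L₂ = x₁S(L₂)L₃
  -- l(x₂S(L₁)) = x₁ l(x₂S(L)). Since SL is again an integral and integrals are two-sided, this is
  -- x₁ε(x₂) = x.
  calc
    _ = H.obj g ◁ (act01 (H.integral g) ≫ act12 (H.comul g)) ≫ (H.obj g ◁ H.anti e ▷ _ ≫
        act21 (H.mul e') ≫ act10 (H.coint i) ≫ act01 (H.one i)) ≫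
        act21 (H.mul (Category.id_comp g)) := by
      simp only [one_left, whiskerLeft_comp, Category.assoc, Category.comp_id]
    _ = act12 (H.comul g) ≫ H.obj g ◁ (H.obj g ◁ (act01 (H.integral g) ≫ act12 (H.comul g) ≫
        H.obj g ◁ (act12 (H.comul g) ≫ H.anti e ▷ _ ≫ act21 (H.mul e''))) ≫
        act20 (H.obj g ◁ H.anti e ≫ H.mul e' ≫ H.coint i)) ≫
        act21 (H.mul (Category.comp_id g)) := by
      rw [H.mul_antipode_coint_comul e e', Category.assoc, Category.assoc,
        H.assoc e' (Category.id_comp g) e'' (Category.comp_id g), ← reassoc_of% nat12]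
      simp only [nat20, ← whiskerLeft_comp_assoc, ← whiskerLeft_comp, Category.assoc,
        reassoc_of% coassoc]
    _ = act12 (H.comul g) ≫ H.obj g ◁ (H.obj g ◁ act01 (H.integral g) ≫
        act20 (H.obj g ◁ H.anti e ≫ H.mul e' ≫ H.coint i)) := by
      have h : H.obj g ◁ (act01 (H.integral g) ≫ H.obj g ◁ act01 (H.one j)) ≫
          act20 (H.obj g ◁ H.anti e ≫ H.mul e' ≫ H.coint i) (R := H.obj (𝟙 j) ⊗ R) =
          (H.obj g ◁ act01 (H.integral g) ≫
            act20 (H.obj g ◁ H.anti e ≫ H.mul e' ≫ H.coint i)) ≫ act01 (H.one j) := by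
        rw [Category.assoc, nat20, whiskerLeft_comp_assoc]
      rw [H.comul_comul_antipode_left e e'', h, whiskerLeft_comp, Category.assoc, one_right,
        Category.comp_id]
    _ = _ := by
      have h : H.obj g ◁ act01 (H.integral g) ≫
          act20 (H.obj g ◁ H.anti e ≫ H.mul e' ≫ H.coint i) (R := R) = act10 (H.counit g) := by
        calc
          _ = H.obj g ◁ (act01 (H.integral g) ≫ H.anti e ▷ R) ≫ act21 (H.mul e') ≫
              act10 (H.coint i) := by
            dsimp only [act20, act21, act10, act01]; monoidal
          _ = _ := by
            rw [H.integral_antipode e, reassoc_of% H.mul_integral, integral_act10_coint,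
              Category.comp_id]
      rw [h, counit_right]

end UnimodularHopf

/-! ### Dual morphisms, nested duals and curls. -/

section

variable {C : Type u₁} [Category.{v₁} C] [MonoidalCategory C]

open ExactPairing

/-- Bending a strand is invertible, so the dual of `f` is characterized by sliding `f` across the
coform. -/
theorem leftAdjointMate_eq_of_coevaluation {X Y : C} [HasLeftDual X] [HasLeftDual Y]
    {f : X ⟶ Y} {f' : HasLeftDual.leftDual Y ⟶ HasLeftDual.leftDual X}
    (h : η_ _ X ≫ _ ◁ f = η_ _ Y ≫ f' ▷ Y) : leftAdjointMate f = f' := by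
  rw [← coevaluation_comp_leftAdjointMate] at h
  have := congr((λ_ _).inv ≫ $h ▷ _ ≫ (α_ _ _ _).hom ≫ _ ◁ ε_ (HasLeftDual.leftDual Y) Y ≫ (ρ_ _).hom)
  have key (a : HasLeftDual.leftDual Y ⟶ HasLeftDual.leftDual X) :
      (λ_ _).inv ≫ (η_ _ Y ≫ a ▷ Y) ▷ _ ≫ (α_ _ _ _).hom ≫ _ ◁ ε_ (HasLeftDual.leftDual Y) Y ≫ (ρ_ _).hom = a := by
    rw [comp_whiskerRight_assoc, associator_naturality_left_assoc, ← whisker_exchange_assoc,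
      evaluation_coevaluation_assoc]
    simp
  rwa [key, key] at this

theorem leftAdjointMate_tensorHom {X X' Y Y' : C} [HasLeftDual X] [HasLeftDual X']
    [HasLeftDual Y] [HasLeftDual Y'] (f : X ⟶ Y) (f' : X' ⟶ Y') :
    @leftAdjointMate _ _ _ (X ⊗ X') (Y ⊗ Y') hasLeftDualTensor hasLeftDualTensor (f ⊗ₘ f') =
      leftAdjointMate f' ⊗ₘ leftAdjointMate f := by
  let : HasLeftDual (X ⊗ X') := hasLeftDualTensor
  let : HasLeftDual (Y ⊗ Y') := hasLeftDualTensor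
  apply leftAdjointMate_eq_of_coevaluation
  have h := coevaluation_comp_leftAdjointMate f
  have h' := coevaluation_comp_leftAdjointMate f'
  have e : η_ (HasLeftDual.leftDual (X ⊗ X')) (X ⊗ X') = η_ (HasLeftDual.leftDual X') X' ⊗≫
      (HasLeftDual.leftDual X' ◁ η_ (HasLeftDual.leftDual X) X) ▷ X' ⊗≫
        𝟙 ((HasLeftDual.leftDual X' ⊗ HasLeftDual.leftDual X) ⊗ X ⊗ X') := rfl
  have e' : η_ (HasLeftDual.leftDual (Y ⊗ Y')) (Y ⊗ Y') = η_ (HasLeftDual.leftDual Y') Y' ⊗≫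
      (HasLeftDual.leftDual Y' ◁ η_ (HasLeftDual.leftDual Y) Y) ▷ Y' ⊗≫
        𝟙 ((HasLeftDual.leftDual Y' ⊗ HasLeftDual.leftDual Y) ⊗ Y ⊗ Y') := rfl
  rw [e, e']
  change _ ≫ (HasLeftDual.leftDual X' ⊗ HasLeftDual.leftDual X) ◁ _ = _
  rw [MonoidalCategory.tensorHom_def, tensorHom_def']
  calc
    _ = η_ (HasLeftDual.leftDual X') X' ⊗≫ HasLeftDual.leftDual X' ◁
          ((η_ (HasLeftDual.leftDual X) X ≫ HasLeftDual.leftDual X ◁ f) ▷ X' ≫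
            (HasLeftDual.leftDual X ⊗ Y) ◁ f') ⊗≫ 𝟙 _ := by
      monoidal
    _ = (η_ (HasLeftDual.leftDual X') X' ≫ HasLeftDual.leftDual X' ◁ f') ⊗≫
          HasLeftDual.leftDual X' ◁
            ((η_ (HasLeftDual.leftDual Y) Y ≫ leftAdjointMate f ▷ Y) ▷ Y') ⊗≫ 𝟙 _ := by
      rw [← whisker_exchange, h]
      monoidal
    _ = η_ (HasLeftDual.leftDual Y') Y' ⊗≫
          (leftAdjointMate f' ▷ (𝟙_ C) ≫ HasLeftDual.leftDual X' ◁
            (η_ (HasLeftDual.leftDual Y) Y ≫ leftAdjointMate f ▷ Y)) ▷ Y' ⊗≫ 𝟙 _ := by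
      rw [← h']
      monoidal
    _ = _ := by
      rw [← whisker_exchange]
      monoidal

variable [BraidedCategory C]

theorem nested_coform_braiding {X X' Y Y' : C} (a : 𝟙_ C ⟶ X' ⊗ X) (b : 𝟙_ C ⟶ Y' ⊗ Y) :
    (b ⊗≫ (Y' ◁ a) ▷ Y ⊗≫ 𝟙 ((Y' ⊗ X') ⊗ X ⊗ Y)) ≫ (Y' ⊗ X') ◁ (β_ X Y).hom =
      (a ⊗≫ (X' ◁ b) ▷ X ⊗≫ 𝟙 ((X' ⊗ Y') ⊗ Y ⊗ X)) ≫ (β_ X' Y').hom ▷ (Y ⊗ X) := by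
  apply ext02
  -- A strand crosses both legs of a coform trivially, so crossing one leg equals uncrossing the
  -- other. Both sides of the goal thus acquire the inverse crossing of `X'` and `Y`, and the two
  -- coforms commute.
  have hl : act02 a (R := Y ⊗ 𝟙_ C) ≫ X' ◁ act22 (β_ X Y).hom =
      Y ◁ act02 a ≫ act22 (β_ X' Y).inv := by
    rw [← braid_left02 a, Category.assoc, Category.assoc, braid_inv, Category.comp_id]
  have hr : X' ◁ act02 b (R := X ⊗ 𝟙_ C) ≫ act22 (β_ X' Y').hom =
      act02 b ≫ Y' ◁ act22 (β_ X' Y).inv := by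
    rw [← braid_right02 b (F := X'), Category.assoc, Category.assoc, ← whiskerLeft_comp, braid_inv,
      whiskerLeft_id, Category.comp_id]
  calc
    _ = (act02 b (R := 𝟙_ C) ≫ Y' ◁ (act02 a ≫ X' ◁ act22 (β_ X Y).hom)) ⊗≫ 𝟙 _ := by
      dsimp only [act02, act22]
      monoidal
    _ = (act02 a (R := 𝟙_ C) ≫ X' ◁ act02 b ≫ act22 (β_ X' Y').hom) ⊗≫ 𝟙 _ := by
      rw [hl, hr, nat02']
    _ = _ := by
      dsimp only [act02, act22]
      monoidal

theorem leftAdjointMate_braiding (X Y : C) [HasLeftDual X] [HasLeftDual Y] :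
    @leftAdjointMate _ _ _ (X ⊗ Y) (Y ⊗ X) hasLeftDualTensor hasLeftDualTensor (β_ X Y).hom =
      (β_ (HasLeftDual.leftDual X) (HasLeftDual.leftDual Y)).hom := by
  let : HasLeftDual (X ⊗ Y) := hasLeftDualTensor
  let : HasLeftDual (Y ⊗ X) := hasLeftDualTensor
  apply leftAdjointMate_eq_of_coevaluation
  have e : η_ (HasLeftDual.leftDual (X ⊗ Y)) (X ⊗ Y) = η_ (HasLeftDual.leftDual Y) Y ⊗≫
      (HasLeftDual.leftDual Y ◁ η_ (HasLeftDual.leftDual X) X) ▷ Y ⊗≫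
        𝟙 ((HasLeftDual.leftDual Y ⊗ HasLeftDual.leftDual X) ⊗ X ⊗ Y) := rfl
  have e' : η_ (HasLeftDual.leftDual (Y ⊗ X)) (Y ⊗ X) = η_ (HasLeftDual.leftDual X) X ⊗≫
      (HasLeftDual.leftDual X ◁ η_ (HasLeftDual.leftDual Y) Y) ▷ X ⊗≫
        𝟙 ((HasLeftDual.leftDual X ⊗ HasLeftDual.leftDual Y) ⊗ Y ⊗ X) := rfl
  rw [e, e']
  clear e e'
  exact nested_coform_braiding _ _

/-- The curl on a self dual object: a coform, a crossing and a form. -/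
def curl {X : C} (η : 𝟙_ C ⟶ X ⊗ X) (ε : X ⊗ X ⟶ 𝟙_ C) : X ⟶ X :=
  (λ_ _).inv ≫ η ▷ X ≫ (α_ _ _ _).hom ≫ X ◁ (β_ X X).hom ≫ (α_ _ _ _).inv ≫ ε ▷ X ≫ (λ_ _).hom

/-- Pulling the free strand through the coform moves the crossing, inverted, onto the form; the next
lemma uses the form to move it onto the coform. -/
theorem curl_eq_left {X : C} (η : 𝟙_ C ⟶ X ⊗ X) (ε : X ⊗ X ⟶ 𝟙_ C) :
    curl η ε = (ρ_ _).inv ≫ X ◁ η ≫ (α_ _ _ _).inv ≫ ((β_ X X).inv ≫ ε) ▷ X ≫ (λ_ _).hom := by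
  have h := BraidedCategory.braiding_naturality_left η X
  rw [BraidedCategory.braiding_tensor_left_hom, braiding_tensorUnit_left] at h
  have h' : η ▷ X ≫ (α_ X X X).hom ≫ X ◁ (β_ X X).hom =
      (λ_ X).hom ≫ (ρ_ X).inv ≫ X ◁ η ≫ (α_ X X X).inv ≫ (β_ X X).inv ▷ X ≫ (α_ X X X).hom := by
    rw [← reassoc_of% h]
    simp
  simp [curl, reassoc_of% h']

theorem curl_eq_right {X : C} (η : 𝟙_ C ⟶ X ⊗ X) (ε : X ⊗ X ⟶ 𝟙_ C) :
    curl η ε = (λ_ _).inv ≫ (η ≫ (β_ X X).inv) ▷ X ≫ (α_ _ _ _).hom ≫ X ◁ ε ≫ (ρ_ _).hom := by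
  have h := BraidedCategory.braiding_naturality_right X ε
  rw [BraidedCategory.braiding_tensor_right_hom, braiding_tensorUnit_right] at h
  have h' : X ◁ (β_ X X).hom ≫ (α_ X X X).inv ≫ ε ▷ X =
      (α_ X X X).inv ≫ (β_ X X).inv ▷ X ≫ (α_ X X X).hom ≫ X ◁ ε ≫ (ρ_ X).hom ≫ (λ_ X).inv := by
    rw [h]
    simp
  simp [curl, reassoc_of% h']

theorem curl_eq_of_braiding_inv_evaluation {X : C} [ExactPairing X X] {t : X ⟶ X}
    (h : (β_ X X).inv ≫ ε_ X X = t ▷ X ≫ ε_ X X) : curl (η_ X X) (ε_ X X) = t := by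
  rw [curl_eq_left, h, comp_whiskerRight_assoc, ← associator_inv_naturality_left_assoc,
    whisker_exchange_assoc, coevaluation_evaluation_assoc]
  simp

theorem coevaluation_braiding_inv {X : C} [ExactPairing X X] {t : X ⟶ X}
    (h : curl (η_ X X) (ε_ X X) = t) : η_ X X ≫ (β_ X X).inv = η_ X X ≫ t ▷ X := by
  -- Bending identifies the two sides with the curl and with `t` straightened by a zigzag.
  apply (tensorRightHomEquiv (𝟙_ C) X X X).symm.injective
  rw [curl_eq_right, Iso.inv_comp_eq] at h
  refine h.trans ?_
  change _ = (η_ X X ≫ t ▷ X) ▷ X ≫ (α_ X X X).hom ≫ X ◁ ε_ X X ≫ (ρ_ X).hom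
  rw [comp_whiskerRight_assoc, associator_naturality_left_assoc, ← whisker_exchange_assoc,
    evaluation_coevaluation_assoc]
  simp

end

/-! ### Self-duality of H_g and its compatibility with the antipode. -/

namespace UnimodularHopf

variable {G : Type u} [Groupoid.{v} G] {C : Type u₁} [Category.{v₁} C]
    [MonoidalCategory C] [BraidedCategory C] (H : UnimodularHopf G C)
  {i j k m : G} {R : C}

def coform (g : i ⟶ j) : 𝟙_ C ⟶ H.obj g ⊗ H.obj g := H.integral g ≫ H.comul g

def form (g : i ⟶ j) : H.obj g ⊗ H.obj g ⟶ 𝟙_ C :=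
  H.obj g ◁ H.anti rfl ≫ H.mul (Groupoid.comp_inv g) ≫ H.coint i

@[reducible]
def pairing (g : i ⟶ j) : ExactPairing (H.obj g) (H.obj g) where
  coevaluation' := H.coform g
  evaluation' := H.form g
  coevaluation_evaluation' := by
    rw [← Iso.inv_comp_eq, ← cancel_mono (λ_ _).hom, Iso.inv_hom_id]
    apply ext11
    rw [id_whiskerRight, ← H.form_coform rfl (Groupoid.comp_inv g)]
    dsimp only [coform, form, act01, act12, act21, act10]
    monoidal
  evaluation_coevaluation' := by
    rw [← Iso.inv_comp_eq, ← cancel_mono (ρ_ _).hom, Iso.inv_hom_id]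
    apply ext11
    rw [id_whiskerRight, ← H.coform_form rfl (Groupoid.comp_inv g)]
    dsimp only [coform, form, act01, act12, act21, act10]
    monoidal

/-- Since lS = l and S reverses products, l(xS(y)) = l(S(xS(y))) = l(S²(y)S(x)). -/
theorem braiding_inv_form (g : i ⟶ j) {g' : j ⟶ i} (e : Groupoid.inv g = g')
    (e' : Groupoid.inv g' = g) :
    (β_ (H.obj g) (H.obj g)).inv ≫ H.form g = (H.anti e ≫ H.anti e') ▷ H.obj g ≫ H.form g := by
  subst e
  rw [Iso.inv_comp_eq, form]
  have h := H.mul_anti (Groupoid.comp_inv g) rfl e' (by simp) (Groupoid.comp_inv g) =≫ H.coint i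
  rw [Category.assoc, H.anti_coint] at h
  conv_lhs => rw [h]
  simp only [MonoidalCategory.tensorHom_def, Category.assoc, comp_whiskerRight,
    BraidedCategory.braiding_naturality_right_assoc]

theorem curl_coform_form (g : i ⟶ j) {g' : j ⟶ i} (e : Groupoid.inv g = g')
    (e' : Groupoid.inv g' = g) : curl (H.coform g) (H.form g) = H.anti e ≫ H.anti e' :=
  letI := H.pairing g
  curl_eq_of_braiding_inv_evaluation (H.braiding_inv_form g e e')

theorem coform_antipode (g : i ⟶ j) {g' : j ⟶ i} (e : Groupoid.inv g = g')
    (e' : Groupoid.inv g' = g) :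
    H.coform g' ≫ H.obj g' ◁ H.anti e' = H.coform g ≫ H.anti e ▷ H.obj g := by
  let := H.pairing g
  have h : H.coform g ≫ (β_ (H.obj g) (H.obj g)).inv =
      H.coform g ≫ (H.anti e ≫ H.anti e') ▷ H.obj g :=
    coevaluation_braiding_inv (H.curl_coform_form g e e')
  -- Here L_{g'} = SL_g and S reverses Δ, so the left side is the coform followed by S² on the first
  -- leg, a crossing, and S. By `h` that S² is an inverse crossing, which cancels.
  calc
    _ = (H.coform g ≫ (H.anti e ≫ H.anti e') ▷ H.obj g) ≫ (β_ (H.obj g) (H.obj g)).hom ≫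
        H.anti e ▷ H.obj g := by
      rw [coform, ← H.integral_anti e, Category.assoc, Category.assoc,
        reassoc_of% H.anti_comul e, MonoidalCategory.tensorHom_def, coform, Category.assoc,
        Category.assoc, BraidedCategory.braiding_naturality_left_assoc, Category.assoc,
        ← whiskerLeft_comp, whisker_exchange]
    _ = _ := by
      rw [← h]
      simp

theorem leftAdjointMate_anti (g : i ⟶ j) {g' : j ⟶ i} (e : Groupoid.inv g = g')
    (e' : Groupoid.inv g' = g) :
    letI : HasLeftDual (H.obj g) := { leftDual := H.obj g, exact := H.pairing g }
    letI : HasLeftDual (H.obj g') := { leftDual := H.obj g', exact := H.pairing g' }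
    leftAdjointMate (H.anti e') = H.anti e := by
  let : HasLeftDual (H.obj g) := { leftDual := H.obj g, exact := H.pairing g }
  let : HasLeftDual (H.obj g') := { leftDual := H.obj g', exact := H.pairing g' }
  exact leftAdjointMate_eq_of_coevaluation (H.coform_antipode g e e')

/-- The preceding duality between the two antipodes, read on forms instead of coforms. -/
theorem antipode_form (g : i ⟶ j) {g' : j ⟶ i} (e : Groupoid.inv g = g')
    (e' : Groupoid.inv g' = g) :
    H.obj g ◁ H.anti e' ≫ H.form g = H.anti e ▷ H.obj g' ≫ H.form g' := by
  let : HasLeftDual (H.obj g) := { leftDual := H.obj g, exact := H.pairing g }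
  let : HasLeftDual (H.obj g') := { leftDual := H.obj g', exact := H.pairing g' }
  have h := leftAdjointMate_comp_evaluation (H.anti e)
  rwa [H.leftAdjointMate_anti g' e' e] at h

theorem leftAdjointMate_anti_anti (g : i ⟶ j) {g' : j ⟶ i} (e : Groupoid.inv g = g')
    (e' : Groupoid.inv g' = g) :
    letI : HasLeftDual (H.obj g) := { leftDual := H.obj g, exact := H.pairing g }
    leftAdjointMate (H.anti e ≫ H.anti e') = H.anti e ≫ H.anti e' := by
  let : HasLeftDual (H.obj g) := { leftDual := H.obj g, exact := H.pairing g }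
  let : HasLeftDual (H.obj g') := { leftDual := H.obj g', exact := H.pairing g' }
  rw [comp_leftAdjointMate, H.leftAdjointMate_anti g e e', H.leftAdjointMate_anti g' e' e]

end UnimodularHopf

/-! ### Twists on products via the double braiding. -/

section

variable {C : Type u₁} [Category.{v₁} C] [MonoidalCategory C] [BraidedCategory C]
  {A A' B B' D D' : C}

/-- The product of two morphisms, composed with the double braiding. -/
def braidedTwist (a : A ⟶ A') (b : B ⟶ B') : A ⊗ B ⟶ A' ⊗ B' :=
  (β_ A B).hom ≫ (b ⊗ₘ a) ≫ (β_ B' A').hom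

theorem braidedTwist_eq (a : A ⟶ A') (b : B ⟶ B') :
    braidedTwist a b = (a ⊗ₘ b) ≫ (β_ A' B').hom ≫ (β_ B' A').hom := by
  rw [braidedTwist, BraidedCategory.braiding_naturality_assoc]

/-- Both sides are the full twist on three strands: the hexagons split it into elementary crossings,
and Yang–Baxter reorders them. -/
theorem double_braiding_associator (A B D : C) :
    ((β_ A B).hom ≫ (β_ B A).hom) ▷ D ≫ (β_ (A ⊗ B) D).hom ≫ (β_ D (A ⊗ B)).hom ≫
        (α_ A B D).hom =
      (α_ A B D).hom ≫ A ◁ ((β_ B D).hom ≫ (β_ D B).hom) ≫ (β_ A (B ⊗ D)).hom ≫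
        (β_ (B ⊗ D) A).hom := by
  rw [BraidedCategory.braiding_naturality_left_assoc,
    BraidedCategory.braiding_naturality_right_assoc A]
  simp only [BraidedCategory.braiding_tensor_left_hom, BraidedCategory.braiding_tensor_right_hom]
  calc
    _ = 𝟙 _ ⊗≫ ((β_ A B).hom ▷ D ⊗≫ B ◁ (β_ A D).hom ⊗≫ (β_ B D).hom ▷ A) ⊗≫
          ((β_ D B).hom ▷ A ⊗≫ B ◁ (β_ D A).hom ⊗≫ (β_ B A).hom ▷ D) ⊗≫ 𝟙 _ := by
      rw [BraidedCategory.yang_baxter', BraidedCategory.yang_baxter']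
      monoidal
    _ = _ := by
      monoidal

theorem braidedTwist_associator (a : A ⟶ A') (b : B ⟶ B') (d : D ⟶ D') :
    braidedTwist (braidedTwist a b) d ≫ (α_ A' B' D').hom =
      (α_ A B D).hom ≫ braidedTwist a (braidedTwist b d) := by
  have e : ((a ⊗ₘ b) ≫ (β_ A' B').hom ≫ (β_ B' A').hom) ⊗ₘ d =
      ((a ⊗ₘ b) ⊗ₘ d) ≫ ((β_ A' B').hom ≫ (β_ B' A').hom) ▷ D' := by
    rw [← tensorHom_id, tensorHom_comp_tensorHom, Category.comp_id]
  have e' : a ⊗ₘ ((b ⊗ₘ d) ≫ (β_ B' D').hom ≫ (β_ D' B').hom) =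
      (a ⊗ₘ b ⊗ₘ d) ≫ A' ◁ ((β_ B' D').hom ≫ (β_ D' B').hom) := by
    rw [← id_tensorHom, tensorHom_comp_tensorHom, Category.comp_id]
  rw [braidedTwist_eq, braidedTwist_eq, braidedTwist_eq a, braidedTwist_eq b, e, e']
  simp only [Category.assoc]
  rw [double_braiding_associator, associator_naturality_assoc]

theorem braidedTwist_comp_tensorHom {E E' : C} {a : A ⟶ A'} {b : B ⟶ B'} {x : A' ⟶ E}
    {y : B' ⟶ E'} {x' : A ⟶ D} {y' : B ⟶ D'} {a' : D ⟶ E} {b' : D' ⟶ E'}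
    (hx : a ≫ x = x' ≫ a') (hy : b ≫ y = y' ≫ b') :
    braidedTwist a b ≫ (x ⊗ₘ y) = (x' ⊗ₘ y') ≫ braidedTwist a' b' := by
  rw [braidedTwist_eq, braidedTwist_eq, tensorHom_comp_tensorHom_assoc, ← hx, ← hy,
    ← tensorHom_comp_tensorHom]
  simp

end

/-! ### The square of the antipode commutes with the structure morphisms. -/

namespace UnimodularHopf

variable {G : Type u} [Groupoid.{v} G] {C : Type u₁} [Category.{v₁} C]
    [MonoidalCategory C] [BraidedCategory C] (H : UnimodularHopf G C)
  {i j k : G}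

theorem anti_counit {g : i ⟶ j} {g' : j ⟶ i} (e : Groupoid.inv g = g') :
    H.anti e ≫ H.counit g' = H.counit g := by
  apply ext10
  rw [← H.antipode_act10_counit e]
  simp [act10]

theorem one_anti (e : Groupoid.inv (𝟙 i) = 𝟙 i) : H.one i ≫ H.anti e = H.one i := by
  apply ext01
  rw [← H.one_antipode e]
  simp [act01]

/-- Each of the two reversals contributes one crossing, and together they form the double braiding
in the twist of a product. The same happens for Δ below. -/
theorem mul_anti_anti {g : i ⟶ j} {h : j ⟶ k} {gh : i ⟶ k} {g' : j ⟶ i} {h' : k ⟶ j}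
    {gh' : k ⟶ i} (e : g ≫ h = gh) (eg : Groupoid.inv g = g') (eg' : Groupoid.inv g' = g)
    (eh : Groupoid.inv h = h') (eh' : Groupoid.inv h' = h) (egh : Groupoid.inv gh = gh')
    (egh' : Groupoid.inv gh' = gh) :
    braidedTwist (H.anti eg ≫ H.anti eg') (H.anti eh ≫ H.anti eh') ≫ H.mul e =
      H.mul e ≫ H.anti egh ≫ H.anti egh' := by
  have e' : h' ≫ g' = gh' := by simp [← eg, ← eh, ← egh, ← e]
  rw [reassoc_of% H.mul_anti e eg eh egh e', H.mul_anti e' eh' eg' egh' e, braidedTwist,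
    BraidedCategory.braiding_naturality_assoc, tensorHom_comp_tensorHom_assoc, Category.assoc,
    Category.assoc, BraidedCategory.braiding_naturality_assoc]

theorem anti_anti_comul {g : i ⟶ j} {g' : j ⟶ i} (e : Groupoid.inv g = g')
    (e' : Groupoid.inv g' = g) :
    (H.anti e ≫ H.anti e') ≫ H.comul g =
      H.comul g ≫ braidedTwist (H.anti e ≫ H.anti e') (H.anti e ≫ H.anti e') := by
  rw [Category.assoc, H.anti_comul e', reassoc_of% H.anti_comul e, braidedTwist,
    BraidedCategory.braiding_naturality_assoc, tensorHom_comp_tensorHom,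
    BraidedCategory.braiding_naturality]

/-- The square of the antipode. -/
@[simps! hom]
noncomputable def antiSq {g : i ⟶ j} {g' : j ⟶ i} (e : Groupoid.inv g = g')
    (e' : Groupoid.inv g' = g) : H.obj g ≅ H.obj g :=
  asIso (H.anti e ≫ H.anti e')

theorem antiSq_comp_anti {g : i ⟶ j} {g' : j ⟶ i} (e : Groupoid.inv g = g')
    (e' : Groupoid.inv g' = g) :
    (H.antiSq e e').hom ≫ H.anti e = H.anti e ≫ (H.antiSq e' e).hom := by
  simp

theorem antiSq_comp_counit {g : i ⟶ j} {g' : j ⟶ i} (e : Groupoid.inv g = g')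
    (e' : Groupoid.inv g' = g) : (H.antiSq e e').hom ≫ H.counit g = H.counit g ≫ 𝟙 _ := by
  simp [anti_counit]

theorem one_comp_antiSq (e : Groupoid.inv (𝟙 i) = 𝟙 i) :
    𝟙 _ ≫ H.one i = H.one i ≫ (H.antiSq e e).hom := by
  rw [antiSq_hom, reassoc_of% H.one_anti, one_anti, Category.id_comp]

theorem antiSq_comp_coint (e : Groupoid.inv (𝟙 i) = 𝟙 i) :
    (H.antiSq e e).hom ≫ H.coint i = H.coint i ≫ 𝟙 _ := by
  simp [anti_coint]

theorem integral_comp_antiSq {g : i ⟶ j} {g' : j ⟶ i} (e : Groupoid.inv g = g')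
    (e' : Groupoid.inv g' = g) :
    𝟙 _ ≫ H.integral g = H.integral g ≫ (H.antiSq e e').hom := by
  rw [antiSq_hom, reassoc_of% integral_anti, integral_anti, Category.id_comp]

end UnimodularHopf

/-! ### The tortile structure on the universal category. -/

namespace UniHopf

open Term

variable {G : Type u} [Groupoid.{v} G]

variable (G) in
/-- The tautological Hopf `G`-algebra in the universal category. -/
def universal : UnimodularHopf G (UniHopf G) where
  obj g := of g
  comul g := mk (comul g)
  counit g := mk (counit g)
  mul e := mk (mul e)
  one i := mk (one i)
  anti e := mk (anti e)
  antiInv e := mk (antiInv e)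
  coint i := mk (coint i)
  integral g := mk (integral g)
  comul_coassoc g := Quotient.sound (Rel.comul_coassoc g)
  counit_comul g := Quotient.sound (Rel.counit_comul g)
  comul_counit g := Quotient.sound (Rel.comul_counit g)
  mul_assoc e₁ e₂ e₃ e₄ := Quotient.sound (Rel.mul_assoc e₁ e₂ e₃ e₄)
  mul_one g := Quotient.sound (Rel.mul_one g)
  one_mul g := Quotient.sound (Rel.one_mul g)
  mul_comul {i j k g h gh} e := by
    have h : (mk (comul g) ⊗ₘ mk (comul h)) ≫ (α_ _ _ _).hom ≫
        (of g ◁ ((α_ _ _ _).inv ≫ (β_ (of g) (of h)).hom ▷ of h ≫ (α_ _ _ _).hom)) ≫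
          (α_ _ _ _).inv ≫ (mk (mul e) ⊗ₘ mk (mul e)) = mk (mul e) ≫ mk (comul gh) :=
      Quotient.sound (Rel.mul_comul e)
    rw [← h, tensorμ]
    simp only [whiskerLeft_comp, Category.assoc]
    rfl
  mul_counit e := Quotient.sound (Rel.mul_counit e)
  one_comul i := Quotient.sound (Rel.one_comul i)
  one_counit i := Quotient.sound (Rel.one_counit i)
  anti_left e e' := Quotient.sound (Rel.anti_left e e')
  anti_right e e' := Quotient.sound (Rel.anti_right e e')
  antiInv_anti e e' := Quotient.sound (Rel.antiInv_anti e e')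
  anti_antiInv e e' := Quotient.sound (Rel.anti_antiInv e e')
  coint_left i := Quotient.sound (Rel.coint_left i)
  integral_right e := Quotient.sound (Rel.integral_right e)
  integral_coint i := Quotient.sound (Rel.integral_coint i)
  integral_anti e := Quotient.sound (Rel.integral_anti e)
  anti_coint i e := Quotient.sound (Rel.anti_coint i e)

/-- The chosen left duals: the generators are self dual. -/
@[reducible]
def leftDual : ∀ A : UniHopf G, HasLeftDual A
  | of g => { leftDual := of g, exact := (universal G).pairing g }
  | unit => hasLeftDualUnit
  | tensor A B => @hasLeftDualTensor _ _ _ A B (leftDual A) (leftDual B)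

theorem inv_inv {i j : G} (g : i ⟶ j) : Groupoid.inv (Groupoid.inv g) = g := by simp

theorem inv_id (i : G) : Groupoid.inv (𝟙 i) = 𝟙 i := by simp

/-- The twist, given on the generators by the square of the antipode. -/
noncomputable def twist : ∀ A : UniHopf G, A ≅ A
  | of g => (universal G).antiSq rfl (inv_inv g)
  | unit => Iso.refl (𝟙_ (UniHopf G))
  | tensor A B => β_ A B ≪≫ (twist B ⊗ᵢ twist A) ≪≫ β_ B A

/-- Frees the label of the inverse. For an identity it can then be the identity itself, as the
statements for the unit and the cointegral require. -/
theorem twist_of {i j : G} (g : i ⟶ j) {g' : j ⟶ i} (e : Groupoid.inv g = g')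
    (e' : Groupoid.inv g' = g) :
    twist (of g) = (universal G).antiSq e e' := by
  subst e
  rfl

theorem twist_tensor (A B : UniHopf G) :
    (twist (A ⊗ B)).hom = braidedTwist (twist A).hom (twist B).hom := rfl

theorem twist_unit : (twist (𝟙_ (UniHopf G))).hom = 𝟙 _ := rfl

theorem inv_twist_naturality {A B : UniHopf G} {f : A ⟶ B} {f' : B ⟶ A} (h : f ≫ f' = 𝟙 A)
    (h' : f' ≫ f = 𝟙 B) (hf : (twist A).hom ≫ f = f ≫ (twist B).hom) :
    (twist B).hom ≫ f' = f' ≫ (twist A).hom := by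
  rw [← Category.comp_id (f' ≫ _), ← h, Category.assoc, reassoc_of% hf, reassoc_of% h']

theorem twist_naturality_associator (A B C : UniHopf G) :
    (twist ((A ⊗ B) ⊗ C)).hom ≫ (α_ A B C).hom = (α_ A B C).hom ≫ (twist (A ⊗ B ⊗ C)).hom := by
  simp only [twist_tensor, braidedTwist_associator]

theorem twist_naturality_leftUnitor (A : UniHopf G) :
    (twist (𝟙_ _ ⊗ A)).hom ≫ (λ_ A).hom = (λ_ A).hom ≫ (twist A).hom := by
  rw [twist_tensor, twist_unit, braidedTwist_eq]
  simp

theorem twist_naturality_rightUnitor (A : UniHopf G) :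
    (twist (A ⊗ 𝟙_ _)).hom ≫ (ρ_ A).hom = (ρ_ A).hom ≫ (twist A).hom := by
  rw [twist_tensor, twist_unit, braidedTwist_eq]
  simp

theorem twist_naturality_braiding (A B : UniHopf G) :
    (twist (A ⊗ B)).hom ≫ (β_ A B).hom = (β_ A B).hom ≫ (twist (B ⊗ A)).hom := by
  rw [twist_tensor, twist_tensor, braidedTwist, braidedTwist_eq, Category.assoc, Category.assoc]

theorem twist_naturality_anti {i j : G} {g : i ⟶ j} {g' : j ⟶ i} (e : Groupoid.inv g = g') :
    (twist (of g)).hom ≫ (universal G).anti e = (universal G).anti e ≫ (twist (of g')).hom := by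
  have e' : Groupoid.inv g' = g := by simp [← e]
  rw [twist_of g e e', twist_of g' e' e]
  exact (universal G).antiSq_comp_anti e e'

/-- Every morphism is represented by a formal one, so induction on terms reduces naturality to the
generators; inverse generators follow from the generators that they invert. -/
theorem twist_naturality_mk {A B : UniHopf G} (f : Term A B) :
    (twist A).hom ≫ mk f = mk f ≫ (twist B).hom := by
  induction f with
  | id A => exact (Category.comp_id _).trans (Category.id_comp _).symm
  | comp f g hf hg =>
    change _ ≫ mk f ≫ mk g = (mk f ≫ mk g) ≫ _
    rw [reassoc_of% hf, hg, Category.assoc]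
  | tens f g hf hg => exact braidedTwist_comp_tensorHom hf hg
  | assoc A B C => exact twist_naturality_associator A B C
  | assocInv A B C =>
    exact inv_twist_naturality (α_ A B C).hom_inv_id (α_ A B C).inv_hom_id
      (twist_naturality_associator A B C)
  | lunit A => exact twist_naturality_leftUnitor A
  | lunitInv A =>
    exact inv_twist_naturality (λ_ A).hom_inv_id (λ_ A).inv_hom_id (twist_naturality_leftUnitor A)
  | runit A => exact twist_naturality_rightUnitor A
  | runitInv A =>
    exact inv_twist_naturality (ρ_ A).hom_inv_id (ρ_ A).inv_hom_id (twist_naturality_rightUnitor A)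
  | braid A B => exact twist_naturality_braiding A B
  | braidInv A B =>
    exact inv_twist_naturality (β_ A B).hom_inv_id (β_ A B).inv_hom_id
      (twist_naturality_braiding A B)
  | comul g => exact (universal G).anti_anti_comul rfl (inv_inv g)
  | counit g => exact (universal G).antiSq_comp_counit rfl (inv_inv g)
  | mul e =>
    exact (universal G).mul_anti_anti e rfl (inv_inv _) rfl (inv_inv _) rfl (inv_inv _)
  | one i =>
    rw [twist_of (𝟙 i) (inv_id i) (inv_id i)]
    exact (universal G).one_comp_antiSq (inv_id i)
  | anti e => exact twist_naturality_anti e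
  | antiInv e =>
    have e' : _ = _ := (congrArg Groupoid.inv e).symm.trans (inv_inv _)
    exact inv_twist_naturality ((universal G).anti_antiInv e' e)
      ((universal G).antiInv_anti e e') (twist_naturality_anti e')
  | coint i =>
    rw [twist_of (𝟙 i) (inv_id i) (inv_id i)]
    exact (universal G).antiSq_comp_coint (inv_id i)
  | integral g => exact (universal G).integral_comp_antiSq rfl (inv_inv g)

theorem twist_leftDual (A : UniHopf G) :
    (twist (leftDual A).leftDual).hom =
      @leftAdjointMate _ _ _ A A (leftDual A) (leftDual A) (twist A).hom := by
  induction A with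
  | of g => exact ((universal G).leftAdjointMate_anti_anti g rfl (inv_inv g)).symm
  | unit =>
    let : HasLeftDual (unit : UniHopf G) := leftDual unit
    exact (leftAdjointMate_id (X := (unit : UniHopf G))).symm
  | tensor A B hA hB =>
    let := leftDual A
    let := leftDual B
    let : HasLeftDual (A ⊗ B) := hasLeftDualTensor
    let : HasLeftDual (B ⊗ A) := hasLeftDualTensor
    change braidedTwist (twist (leftDual B).leftDual).hom (twist (leftDual A).leftDual).hom =
      leftAdjointMate (X := A ⊗ B) (Y := A ⊗ B)
        ((β_ A B).hom ≫ ((twist B).hom ⊗ₘ (twist A).hom) ≫ (β_ B A).hom)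
    rw [hA, hB, braidedTwist, ← leftAdjointMate_tensorHom, ← leftAdjointMate_braiding,
      ← leftAdjointMate_braiding]
    -- Dualization reverses the three-fold composite, which is symmetric in form: crossing, product
    -- of twists, crossing.
    exact (comp_leftAdjointMate.trans
      ((congrArg (· ≫ _) comp_leftAdjointMate).trans (Category.assoc _ _ _))).symm

/-- The tortile structure of the universal category. -/
@[reducible]
noncomputable def tortile : TortileCategory (UniHopf G) where
  leftDual := leftDual
  twist := twist
  twist_naturality := by
    rintro _ _ ⟨f⟩
    exact twist_naturality_mk f
  twist_unit := twist_unit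
  twist_tensor _ _ := rfl
  twist_dual := twist_leftDual

end UniHopf

theorem mainTheorem9 (G : Type u) [Groupoid.{v} G] :
    (∃ T : TortileCategory (UniHopf G),
      -- the duals: `H_g` is its own dual, with coform `Λ_g` and form `λ_g`
      (∀ {i j : G} (g : i ⟶ j), ∃ p : ExactPairing (UniHopf.of g) (UniHopf.of g),
        T.leftDual (UniHopf.of g) = ⟨UniHopf.of g⟩ ∧
        p.coevaluation' = UniHopf.coform g ∧ p.evaluation' = UniHopf.form g) ∧
      T.leftDual (𝟙_ (UniHopf G)) = hasLeftDualUnit ∧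
      (∀ A B : UniHopf G, T.leftDual (A ⊗ B) =
        @hasLeftDualTensor _ _ _ A B (T.leftDual A) (T.leftDual B)) ∧
      -- the twist on the generating objects
      (∀ {i j : G} (g : i ⟶ j),
        (T.twist (UniHopf.of g)).hom = UniHopf.S g ≫ UniHopf.SOfInv g)) ∧
    -- the curl built from form, braiding and coform, and its dual, are both `S_{g⁻¹} ∘ S_g`
    (∀ {i j : G} (g : i ⟶ j),
      (λ_ _).inv ≫ UniHopf.coform g ▷ UniHopf.of g ≫ (α_ _ _ _).hom ≫
        UniHopf.of g ◁ (β_ (UniHopf.of g) (UniHopf.of g)).hom ≫ (α_ _ _ _).inv ≫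
        UniHopf.form g ▷ UniHopf.of g ≫ (λ_ _).hom = UniHopf.S g ≫ UniHopf.SOfInv g) ∧
    (∀ {i j : G} (g : i ⟶ j),
      (λ_ _).inv ≫ UniHopf.coform g ▷ UniHopf.of g ≫
        (UniHopf.of g ◁ (UniHopf.S g ≫ UniHopf.SOfInv g)) ▷ UniHopf.of g ≫ (α_ _ _ _).hom ≫
        UniHopf.of g ◁ UniHopf.form g ≫ (ρ_ _).hom = UniHopf.S g ≫ UniHopf.SOfInv g) ∧
    -- coform and form commute with the antipode
    (∀ {i j : G} (g : i ⟶ j),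
      UniHopf.coform (Groupoid.inv g) ≫ UniHopf.of (Groupoid.inv g) ◁ UniHopf.SOfInv g =
        UniHopf.coform g ≫ UniHopf.S g ▷ UniHopf.of g) ∧
    (∀ {i j : G} (g : i ⟶ j),
      UniHopf.of g ◁ UniHopf.SOfInv g ≫ UniHopf.form g =
        UniHopf.S g ▷ UniHopf.of (Groupoid.inv g) ≫ UniHopf.form (Groupoid.inv g)) := by
  refine ⟨⟨UniHopf.tortile, fun g => ⟨(UniHopf.universal G).pairing g, rfl, rfl, rfl⟩, rfl,
    fun _ _ => rfl, fun g => rfl⟩, ?_, ?_, ?_, ?_⟩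
  · exact fun g => (UniHopf.universal G).curl_coform_form g rfl (UniHopf.inv_inv g)
  -- The displayed composite is the dual morphism of S² unfolded.
  · exact fun g => (UniHopf.universal G).leftAdjointMate_anti_anti g rfl (UniHopf.inv_inv g)
  · exact fun g => (UniHopf.universal G).coform_antipode g rfl (UniHopf.inv_inv g)
  · exact fun g => (UniHopf.universal G).antipode_form g rfl (UniHopf.inv_inv g)
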